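/- Fix $0<\mu\le\frac12$, $0<q_1\le1$, $A_2\ge0$, $c_d>0$; put $n=\sqrt{1+\frac32A_2}$, $W_1=(1-\mu)(1-q_1)/c_d$, $r_1^2=(x+\mu)^2+y^2$, $r_2^2=(x+\mu-1)^2+y^2$, and consider the Lagrangian $$L=\tfrac12(\dot x^2+\dot y^2)+n(x\dot y-\dot xy)+\tfrac{n^2}{2}(x^2+y^2)+\frac{(1-\mu)q_1}{r_1}+\frac{\mu}{r_2}+\frac{\mu A_2}{2r_2^3}+W_1\Big\{\frac{(x+\mu)\dot x+y\dot y}{2r_1^2}-n\arctan\frac{y}{x+\mu}\Big\}$$ with $p_x=\partial L/\partial\dot x$, $p_y=\partial L/\partial\dot y$ and Hamiltonian $H=-L+p_x\dot x+p_y\dot y$. Let $(x_*,y_*)$ be a triangular equilibrium, i.e. a rest point of $$\ddot x-2n\dot y=\frac{\partial U_1}{\partial x}-\frac{W_1N_1}{r_1^2},\qquad \ddot y+2n\dot x=\frac{\partial U_1}{\partial y}-\frac{W_1N_2}{r_1^2},$$ with $U_1=\frac{n^2(x^2+y^2)}2+\frac{(1-\mu)q_1}{r_1}+\frac\mu{r_2}+\frac{\mu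 A_2}{2r_2^3}$, $N_1=\frac{(x+\mu)[(x+\mu)\dot x+y\dot y]}{r_1^2}+\dot x-ny$, $N_2=\frac{y[(x+\mu)\dot x+y\dot y]}{r_1^2}+\dot y+n(x+\mu)$, and assume $y_*\ne0$, $x_*+\mu\neq0$. Shift the origin to $(x_*,y_*)$ and let $L_k$ be the homogeneous part of degree $k$ of the Taylor expansion of $L$ in $(x,y,\dot x,\dot y)$. Define $E,F,G$ by $L_2(x,y,0,0)=\frac{n^2}{2}(x^2+y^2)-Ex^2-Fy^2-Gxy$ and $H_2=\frac12(p_x^2+p_y^2)+n(yp_x-xp_y)+Ex^2+Fy^2+Gxy$. Assume that the characteristic equation $\lambda^4+2(E+F+n^2)\lambda^2+4EF-G^2+n^4-2n^2(E+F)=0$ has roots $\pm i\omega_1,\pm i\omega_2$ with $0<\omega_2<\omega_1$, and that $k_1\omega_1+k_2\omega_2\ne0$ for all integers $(k_1,k_2)\neq(0,0)$ with $|k_1|+|k_2|\le4$. A homogeneous double D'Alembert component of degree $k$ is a function $$\sum_{0\le m\le k}I_1^{\frac{k-m}2}I_2^{\frac m2}\sum_{p,q}\big[C_{k-m,m,p,q}\cos(p\phi_1+q\phi_2)+S_{k-m,m,p,q}\sin(p\phi_1+q\phi_2)\big]\qquad(I_1,I_2\ge0),$$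 where $0\le p\le k-m$ has the parity of $k-m$ and $-m\le q\le m$ has the parity of $m$. Let $D=\omega_1\partial_{\phi_1}-\omega_2\partial_{\phi_2}$. Put $l_j=2\sqrt{\omega_j^2+n^2-2F}$ and $\kappa=\sqrt{\omega_1^2-\omega_2^2}$, let $P_i=\sqrt{2I_i\omega_i}\cos\phi_i$, $Q_i=\sqrt{2I_i/\omega_i}\sin\phi_i$, and let $(x,y,p_x,p_y)^T=J(Q_1,Q_2,P_1,P_2)^T$ be given by $x=J_{13}P_1+J_{14}P_2$, $y=J_{21}Q_1+J_{22}Q_2+J_{23}P_1+J_{24}P_2$, $p_x=Dx-ny$, $p_y=Dy+nx$, with $$J_{13}=\frac{l_1}{2\omega_1\kappa},\quad J_{14}=\frac{l_2}{2\omega_2\kappa},\quad J_{21}=-\frac{4n\omega_1}{l_1\kappa},\quad J_{22}=\frac{4n\omega_2}{l_2\kappa},\quad J_{23}=\frac{2G}{\omega_1l_1\kappa},\quad J_{24}=\frac{2G}{\omega_2l_2\kappa}.$$ Then: (1) $J$ is symplectic and turns $H_2$ into $\omega_1I_1-\omega_2I_2$. Accordingly let the first-order components $B_1^{1,0}$,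 $B_1^{0,1}$ be the above $x$, $y$; they are homogeneous D'Alembert components of degree $1$. (2) Let $X_2=\frac{\partial L_3}{\partial x}-D\frac{\partial L_3}{\partial\dot x}$ and $Y_2=\frac{\partial L_3}{\partial y}-D\frac{\partial L_3}{\partial\dot y}$, evaluated at $x=B_1^{1,0}$, $y=B_1^{0,1}$, $\dot x=DB_1^{1,0}$, $\dot y=DB_1^{0,1}$. The equations $$(D^2+2E-n^2)B_2^{1,0}-(2nD-G)B_2^{0,1}=X_2,\qquad(2nD+G)B_2^{1,0}+(D^2+2F-n^2)B_2^{0,1}=Y_2$$ have exactly one solution $(B_2^{1,0},B_2^{0,1})$ in homogeneous D'Alembert components of degree $2$. The divisors $\triangle_{p,q}=[\omega_1^2-(\omega_1p-\omega_2q)^2][\omega_2^2-(\omega_1p-\omega_2q)^2]$ for the indices $(p,q)$ of degree $2$ are nonzero; $\Phi_2=(D^2+2F-n^2)X_2+(2nD-G)Y_2$ and $\Psi_2=(2nD+G)X_2-(D^2+2E-n^2)Y_2$ are homogeneous D'Alembert components of degree $2$; and $B_2^{1,0}$, $B_2^{0,1}$ are obtained from $\Phi_2$, $-\Psi_2$ by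 dividing the coefficients of $\cos(p\phi_1+q\phi_2)$, $\sin(p\phi_1+q\phi_2)$ by $\triangle_{p,q}$. (3) After the substitution $x=B_1^{1,0}+B_2^{1,0}$, $y=B_1^{0,1}+B_2^{0,1}$ (with $\dot x=Dx$, $\dot y=Dy$) the part of $H$ of order $3$ in $I_1^{1/2},I_2^{1/2}$, written as $$H_3=A_{3,0}I_1^{3/2}+A_{2,1}I_1I_2^{1/2}+A_{1,2}I_1^{1/2}I_2+A_{0,3}I_2^{3/2}$$ with coefficients $A_{i,j}$ depending on $(\phi_1,\phi_2)$, has $A_{3,0}=A_{2,1}=A_{1,2}=A_{0,3}=0$ identically. -/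

import Mathlib

/-- The data of the planar generalized photogravitational restricted three body problem:
mass parameter `μ`, mass reduction factor `q₁` of the radiating primary, oblateness coefficient
`A₂` of the smaller primary, dimensionless velocity of light `cd`, together with
a point `(xs, ys)` of the rotating plane and two positive numbers `ω₁, ω₂`
(the theorem asks that `(xs, ys)` is a triangular equilibrium, and that `ω₁, ω₂` are the basic
frequencies there). -/
structure PRModel where
  μ : ℝ
  q₁ : ℝ
  A₂ : ℝ
  cd : ℝ
  xs : ℝ
  ys : ℝ
  ω₁ : ℝ
  ω₂ : ℝ

/-- Real functions of the actions `I₁, I₂` and the angles `φ₁, φ₂`, in this order. -/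
abbrev ActionAngleFun : Type := ℝ → ℝ → ℝ → ℝ → ℝ

/-- The indices `p` in `0 ≤ p ≤ k` of the same parity as `k`. -/
def dAlembertP (k : ℕ) : Finset ℕ := (Finset.range (k + 1)).filter (fun p => p % 2 = k % 2)

/-- The indices `q` in `-m ≤ q ≤ m` of the same parity as `m`. -/
noncomputable def dAlembertQ (m : ℕ) : Finset ℤ :=
  (Finset.Icc (-(m : ℤ)) (m : ℤ)).filter (fun q => q % 2 = (m : ℤ) % 2)

/-- The homogeneous double D'Alembert component of degree `k` (in `I₁^{1/2}, I₂^{1/2}`) with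
coefficients `C_{k-m,m,p,q} = C m p q` and `S_{k-m,m,p,q} = S m p q`. -/
noncomputable def dAlembertComp (k : ℕ) (C S : ℕ → ℕ → ℤ → ℝ) : ActionAngleFun :=
  fun I₁ I₂ φ₁ φ₂ =>
    ∑ m ∈ Finset.range (k + 1), √I₁ ^ (k - m) * √I₂ ^ m *
      ∑ p ∈ dAlembertP (k - m), ∑ q ∈ dAlembertQ m,
        (C m p q * Real.cos (p * φ₁ + q * φ₂) + S m p q * Real.sin (p * φ₁ + q * φ₂))

/-- Equality of two functions of action-angle variables, for all actions `I₁, I₂ ≥ 0`. -/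
def ActionAngleFun.Agree (f g : ActionAngleFun) : Prop :=
  ∀ I₁ I₂ φ₁ φ₂ : ℝ, 0 ≤ I₁ → 0 ≤ I₂ → f I₁ I₂ φ₁ φ₂ = g I₁ I₂ φ₁ φ₂

/-- `f` is a homogeneous double D'Alembert component of degree `k`. -/
def IsDAlembertComp (k : ℕ) (f : ActionAngleFun) : Prop :=
  ∃ C S : ℕ → ℕ → ℤ → ℝ, ActionAngleFun.Agree f (dAlembertComp k C S)

namespace PRModel

/-- The mean motion, `n² = 1 + (3/2) A₂`. -/
noncomputable def n (M : PRModel) : ℝ := √(1 + 3 / 2 * M.A₂)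

/-- The Poynting-Robertson drag coefficient `W₁ = (1 - μ)(1 - q₁) / c_d`. -/
noncomputable def W₁ (M : PRModel) : ℝ := (1 - M.μ) * (1 - M.q₁) / M.cd

/-- Distance to the radiating primary. -/
noncomputable def r₁ (M : PRModel) (x y : ℝ) : ℝ := √((x + M.μ) ^ 2 + y ^ 2)

/-- Distance to the oblate primary. -/
noncomputable def r₂ (M : PRModel) (x y : ℝ) : ℝ := √((x + M.μ - 1) ^ 2 + y ^ 2)

noncomputable def U₁ (M : PRModel) (x y : ℝ) : ℝ :=
  M.n ^ 2 * (x ^ 2 + y ^ 2) / 2 + (1 - M.μ) * M.q₁ / M.r₁ x y + M.μ / M.r₂ x y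
    + M.μ * M.A₂ / (2 * M.r₂ x y ^ 3)

/-- The drag factors `N₁, N₂` at position `(x, y)` and velocity `(u, v)`. -/
noncomputable def N₁ (M : PRModel) (x y u v : ℝ) : ℝ :=
  (x + M.μ) * ((x + M.μ) * u + y * v) / M.r₁ x y ^ 2 + u - M.n * y

noncomputable def N₂ (M : PRModel) (x y u v : ℝ) : ℝ :=
  y * ((x + M.μ) * u + y * v) / M.r₁ x y ^ 2 + v + M.n * (x + M.μ)

/-- The right-hand sides `U_x, U_y` of the equations of motion
`ẍ - 2nẏ = U_x`, `ÿ + 2nẋ = U_y`. -/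
noncomputable def Ux (M : PRModel) (x y u v : ℝ) : ℝ :=
  deriv (fun t => M.U₁ t y) x - M.W₁ * M.N₁ x y u v / M.r₁ x y ^ 2

noncomputable def Uy (M : PRModel) (x y u v : ℝ) : ℝ :=
  deriv (fun t => M.U₁ x t) y - M.W₁ * M.N₂ x y u v / M.r₁ x y ^ 2

/-- `(xs, ys)` is a triangular equilibrium point: `U_x = U_y = 0` at rest, and `ys ≠ 0`. -/
def IsTriangularEquilibrium (M : PRModel) : Prop :=
  M.Ux M.xs M.ys 0 0 = 0 ∧ M.Uy M.xs M.ys 0 0 = 0 ∧ M.ys ≠ 0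

/-- The Lagrangian at position `(x, y)` and velocity `(u, v)`. -/
noncomputable def L (M : PRModel) (x y u v : ℝ) : ℝ :=
  (u ^ 2 + v ^ 2) / 2 + M.n * (x * v - u * y) + M.n ^ 2 / 2 * (x ^ 2 + y ^ 2)
    + (1 - M.μ) * M.q₁ / M.r₁ x y + M.μ / M.r₂ x y + M.μ * M.A₂ / (2 * M.r₂ x y ^ 3)
    + M.W₁ * (((x + M.μ) * u + y * v) / (2 * M.r₁ x y ^ 2)
        - M.n * Real.arctan (y / (x + M.μ)))

/-- The momenta `p_x = ∂L/∂ẋ`, `p_y = ∂L/∂ẏ`. -/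
noncomputable def px (M : PRModel) (x y u v : ℝ) : ℝ := deriv (fun t => M.L x y t v) u

noncomputable def py (M : PRModel) (x y u v : ℝ) : ℝ := deriv (fun t => M.L x y u t) v

/-- The Hamiltonian `H = -L + p_x ẋ + p_y ẏ`, as a function of position and velocity. -/
noncomputable def H (M : PRModel) (x y u v : ℝ) : ℝ :=
  -M.L x y u v + M.px x y u v * u + M.py x y u v * v

/-- `L_k`: the homogeneous part of degree `k` of the power series expansion of the Lagrangian at
the equilibrium, in the shifted coordinates `(x, y)` and the velocities `(u, v)`. -/
noncomputable def Lpart (M : PRModel) (k : ℕ) (x y u v : ℝ) : ℝ :=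
  iteratedDeriv k (fun s : ℝ => M.L (M.xs + s * x) (M.ys + s * y) (s * u) (s * v)) 0
    / (k.factorial : ℝ)

/-- The coefficients `E, F, G` are determined by
`L₂(x, y, 0, 0) = (n²/2)(x² + y²) - E x² - F y² - G x y`. -/
noncomputable def E (M : PRModel) : ℝ := M.n ^ 2 / 2 - M.Lpart 2 1 0 0 0

noncomputable def F (M : PRModel) : ℝ := M.n ^ 2 / 2 - M.Lpart 2 0 1 0 0

noncomputable def G (M : PRModel) : ℝ := M.n ^ 2 - M.E - M.F - M.Lpart 2 1 1 0 0

/-- The quadratic Hamiltonian `H₂` at the phase point `X = (x, y, p_x, p_y)`. -/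
noncomputable def H₂ (M : PRModel) (X : Fin 2 ⊕ Fin 2 → ℝ) : ℝ :=
  (X (.inr 0) ^ 2 + X (.inr 1) ^ 2) / 2
    + M.n * (X (.inl 1) * X (.inr 0) - X (.inl 0) * X (.inr 1))
    + M.E * X (.inl 0) ^ 2 + M.F * X (.inl 1) ^ 2 + M.G * (X (.inl 0) * X (.inl 1))

/-- The left-hand side of the characteristic equation of `H₂`. -/
noncomputable def charEq (M : PRModel) (z : ℂ) : ℂ :=
  z ^ 4 + 2 * (M.E + M.F + M.n ^ 2) * z ^ 2
    + (4 * M.E * M.F - M.G ^ 2 + M.n ^ 4 - 2 * M.n ^ 2 * (M.E + M.F))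

/-- `±iω₁, ±iω₂` are the characteristic roots, with `0 < ω₂ < ω₁`. -/
def HasFrequencies (M : PRModel) : Prop :=
  0 < M.ω₂ ∧ M.ω₂ < M.ω₁ ∧ M.charEq (Complex.I * M.ω₁) = 0 ∧ M.charEq (Complex.I * M.ω₂) = 0

/-- No resonance up to order 4. -/
def NonResonant (M : PRModel) : Prop :=
  ∀ k₁ k₂ : ℤ, (k₁, k₂) ≠ (0, 0) → |k₁| + |k₂| ≤ 4 → (k₁ : ℝ) * M.ω₁ + k₂ * M.ω₂ ≠ 0

/-- `l_j² = 4 (ω_j² + n² - 2F)`, which is `4 ω_j² + 9` for the classical problem. -/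
noncomputable def l₁ (M : PRModel) : ℝ := √(4 * (M.ω₁ ^ 2 + M.n ^ 2 - 2 * M.F))

noncomputable def l₂ (M : PRModel) : ℝ := √(4 * (M.ω₂ ^ 2 + M.n ^ 2 - 2 * M.F))

/-- `k² = ω₁² - ω₂²`, which is `2 ω₁² - 1 = 1 - 2 ω₂²` for the classical problem. -/
noncomputable def k (M : PRModel) : ℝ := √(M.ω₁ ^ 2 - M.ω₂ ^ 2)

noncomputable def J₁₃ (M : PRModel) : ℝ := M.l₁ / (2 * M.ω₁ * M.k)

noncomputable def J₁₄ (M : PRModel) : ℝ := M.l₂ / (2 * M.ω₂ * M.k)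

noncomputable def J₂₁ (M : PRModel) : ℝ := -(4 * M.n * M.ω₁) / (M.l₁ * M.k)

noncomputable def J₂₂ (M : PRModel) : ℝ := 4 * M.n * M.ω₂ / (M.l₂ * M.k)

noncomputable def J₂₃ (M : PRModel) : ℝ := 2 * M.G / (M.ω₁ * M.l₁ * M.k)

noncomputable def J₂₄ (M : PRModel) : ℝ := 2 * M.G / (M.ω₂ * M.l₂ * M.k)

/-- The matrix of the linear normalization `(x, y, p_x, p_y) = J (Q₁, Q₂, P₁, P₂)`. -/
noncomputable def J (M : PRModel) : Matrix (Fin 2 ⊕ Fin 2) (Fin 2 ⊕ Fin 2) ℝ :=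
  Matrix.fromBlocks
    !![0, 0;
       M.J₂₁, M.J₂₂]
    !![M.J₁₃, M.J₁₄;
       M.J₂₃, M.J₂₄]
    !![-M.ω₁ ^ 2 * M.J₁₃ - M.n * M.J₂₁, M.ω₂ ^ 2 * M.J₁₄ - M.n * M.J₂₂;
       -M.ω₁ ^ 2 * M.J₂₃, M.ω₂ ^ 2 * M.J₂₄]
    !![-M.n * M.J₂₃, -M.n * M.J₂₄;
       M.J₂₁ + M.n * M.J₁₃, -M.J₂₂ + M.n * M.J₁₄]

/-- The normal coordinates `T = (Q₁, Q₂, P₁, P₂)` in terms of action-angle variables. -/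
noncomputable def T (M : PRModel) (I₁ I₂ φ₁ φ₂ : ℝ) : Fin 2 ⊕ Fin 2 → ℝ :=
  Sum.elim
    ![√(2 * I₁ / M.ω₁) * Real.sin φ₁, √(2 * I₂ / M.ω₂) * Real.sin φ₂]
    ![√(2 * I₁ * M.ω₁) * Real.cos φ₁, √(2 * I₂ * M.ω₂) * Real.cos φ₂]

/-- The first order components `B₁^{1,0}`, `B₁^{0,1}`: the coordinates `x, y` of the linear
normal form. -/
noncomputable def B₁x (M : PRModel) : ActionAngleFun :=
  fun I₁ I₂ φ₁ φ₂ => Matrix.mulVec M.J (M.T I₁ I₂ φ₁ φ₂) (.inl 0)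

noncomputable def B₁y (M : PRModel) : ActionAngleFun :=
  fun I₁ I₂ φ₁ φ₂ => Matrix.mulVec M.J (M.T I₁ I₂ φ₁ φ₂) (.inl 1)

/-- The operator `D = ω₁ ∂/∂φ₁ - ω₂ ∂/∂φ₂`. -/
noncomputable def D (M : PRModel) (f : ActionAngleFun) : ActionAngleFun :=
  fun I₁ I₂ φ₁ φ₂ =>
    M.ω₁ * deriv (fun t => f I₁ I₂ t φ₂) φ₁ - M.ω₂ * deriv (fun t => f I₁ I₂ φ₁ t) φ₂

/-- A function of `(x, y, ẋ, ẏ)` evaluated along the first order components, where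
`ẋ = D B₁^{1,0}` and `ẏ = D B₁^{0,1}`. -/
noncomputable def alongFirstOrder (M : PRModel) (g : ℝ → ℝ → ℝ → ℝ → ℝ) : ActionAngleFun :=
  fun I₁ I₂ φ₁ φ₂ => g (M.B₁x I₁ I₂ φ₁ φ₂) (M.B₁y I₁ I₂ φ₁ φ₂)
    (M.D M.B₁x I₁ I₂ φ₁ φ₂) (M.D M.B₁y I₁ I₂ φ₁ φ₂)

/-- The contribution `X₂ = ∂L₃/∂x - d/dt (∂L₃/∂ẋ)` of `L₃` to Lagrange's equation for `x`, along
the first order components (on which `d/dt` is `D`). -/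
noncomputable def X₂ (M : PRModel) : ActionAngleFun :=
  fun I₁ I₂ φ₁ φ₂ =>
    M.alongFirstOrder (fun x y u v => deriv (fun t => M.Lpart 3 t y u v) x) I₁ I₂ φ₁ φ₂
    - M.D (M.alongFirstOrder (fun x y u v => deriv (fun t => M.Lpart 3 x y t v) u)) I₁ I₂ φ₁ φ₂

/-- The contribution `Y₂ = ∂L₃/∂y - d/dt (∂L₃/∂ẏ)` of `L₃` to Lagrange's equation for `y`. -/
noncomputable def Y₂ (M : PRModel) : ActionAngleFun :=
  fun I₁ I₂ φ₁ φ₂ =>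
    M.alongFirstOrder (fun x y u v => deriv (fun t => M.Lpart 3 x t u v) y) I₁ I₂ φ₁ φ₂
    - M.D (M.alongFirstOrder (fun x y u v => deriv (fun t => M.Lpart 3 x y u t) v)) I₁ I₂ φ₁ φ₂

/-- The two partial differential equations for the second order components:
`(D² + 2E - n²) Bx - (2nD - G) By = X₂` and `(2nD + G) Bx + (D² + 2F - n²) By = Y₂`. -/
def SolvesSecondOrder (M : PRModel) (Bx By : ActionAngleFun) : Prop :=
  ActionAngleFun.Agree
    (fun I₁ I₂ φ₁ φ₂ =>
      (M.D (M.D Bx) I₁ I₂ φ₁ φ₂ + (2 * M.E - M.n ^ 2) * Bx I₁ I₂ φ₁ φ₂)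
        - (2 * M.n * M.D By I₁ I₂ φ₁ φ₂ - M.G * By I₁ I₂ φ₁ φ₂)) M.X₂ ∧
  ActionAngleFun.Agree
    (fun I₁ I₂ φ₁ φ₂ =>
      (2 * M.n * M.D Bx I₁ I₂ φ₁ φ₂ + M.G * Bx I₁ I₂ φ₁ φ₂)
        + (M.D (M.D By) I₁ I₂ φ₁ φ₂ + (2 * M.F - M.n ^ 2) * By I₁ I₂ φ₁ φ₂)) M.Y₂

/-- `Φ₂ = (D² + 2F - n²) X₂ + (2nD - G) Y₂`. -/
noncomputable def Φ₂ (M : PRModel) : ActionAngleFun :=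
  fun I₁ I₂ φ₁ φ₂ =>
    (M.D (M.D M.X₂) I₁ I₂ φ₁ φ₂ + (2 * M.F - M.n ^ 2) * M.X₂ I₁ I₂ φ₁ φ₂)
      + (2 * M.n * M.D M.Y₂ I₁ I₂ φ₁ φ₂ - M.G * M.Y₂ I₁ I₂ φ₁ φ₂)

/-- `Ψ₂ = (2nD + G) X₂ - (D² + 2E - n²) Y₂`. -/
noncomputable def Ψ₂ (M : PRModel) : ActionAngleFun :=
  fun I₁ I₂ φ₁ φ₂ =>
    (2 * M.n * M.D M.X₂ I₁ I₂ φ₁ φ₂ + M.G * M.X₂ I₁ I₂ φ₁ φ₂)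
      - (M.D (M.D M.Y₂) I₁ I₂ φ₁ φ₂ + (2 * M.E - M.n ^ 2) * M.Y₂ I₁ I₂ φ₁ φ₂)

/-- The divisor `Δ_{p,q} = [ω₁² - (ω₁p - ω₂q)²] [ω₂² - (ω₁p - ω₂q)²]`. -/
noncomputable def Δ (M : PRModel) (p : ℕ) (q : ℤ) : ℝ :=
  (M.ω₁ ^ 2 - (M.ω₁ * p - M.ω₂ * q) ^ 2) * (M.ω₂ ^ 2 - (M.ω₁ * p - M.ω₂ * q) ^ 2)

/-- The third order part, in `I₁^{1/2}, I₂^{1/2}`, of the Hamiltonian after the substitution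
`x = B₁^{1,0} + Bx`, `y = B₁^{0,1} + By` (in the shifted coordinates), with
`ẋ = D B₁^{1,0} + D Bx`, `ẏ = D B₁^{0,1} + D By`, where `Bx, By` are homogeneous of degree 2.
Replacing `I₁^{1/2}, I₂^{1/2}` by `s I₁^{1/2}, s I₂^{1/2}` multiplies the components of degree 1
and 2 by `s` and `s²`; the third order part is the coefficient of `s³`. -/
noncomputable def H₃ (M : PRModel) (Bx By : ActionAngleFun) : ActionAngleFun :=
  fun I₁ I₂ φ₁ φ₂ =>
    iteratedDeriv 3 (fun s : ℝ => M.H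
      (M.xs + (s * M.B₁x I₁ I₂ φ₁ φ₂ + s ^ 2 * Bx I₁ I₂ φ₁ φ₂))
      (M.ys + (s * M.B₁y I₁ I₂ φ₁ φ₂ + s ^ 2 * By I₁ I₂ φ₁ φ₂))
      (s * M.D M.B₁x I₁ I₂ φ₁ φ₂ + s ^ 2 * M.D Bx I₁ I₂ φ₁ φ₂)
      (s * M.D M.B₁y I₁ I₂ φ₁ φ₂ + s ^ 2 * M.D By I₁ I₂ φ₁ φ₂)) 0 / (Nat.factorial 3 : ℝ)

end PRModel

/-!
The velocity-dependent part of the drag is the time derivative `dS/dt` of the function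
`S = (W₁ / 2) log |z + μ|` along the motion. Such a gauge term contributes neither to the
Euler–Lagrange equations nor to the Hamiltonian, so that `H = (ẋ² + ẏ²) / 2 - V` with `V` the
velocity-independent part of `L`. The inequality `ΔV ≥ 2n²` gives `E + F < n²`, which together with
the characteristic equation yields `2F < n²`: the matrix `J` is real.

On the Fourier coefficients of D'Alembert components the operator `D` is multiplication by
`i (ω₁ p - ω₂ q)`. The equations of second order are thus a family of linear systems of size two,
with determinants `Δ_{p,q}`, and Cramer's rule solves them. Since the components of a given degree
form a space of finite dimension, solvability for all right-hand sides gives uniqueness.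

Finally `H₃` is a D'Alembert component of degree three with `D H₃ = 0`, by conservation of energy at
third order, and without resonances `D` is injective on such components.
-/

open Filter
open scoped Topology

section Taylor

variable {E F : Type*} [NormedAddCommGroup E] [NormedSpace ℝ E] [NormedAddCommGroup F]
  [NormedSpace ℝ F] {f : E → F} {a : E}

theorem deriv_quadraticCurve (a v w : E) :
    deriv (fun s : ℝ => a + s • v + s ^ 2 • w) = fun s => v + (2 * s) • w := by
  funext s
  have h := (((hasDerivAt_id' s).smul_const v).const_add a).fun_add
    ((hasDerivAt_pow 2 s).smul_const w)
  simpa using h.deriv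

theorem iteratedDeriv_two_quadraticCurve (a v w : E) :
    iteratedDeriv 2 (fun s : ℝ => a + s • v + s ^ 2 • w) = fun _ => (2 : ℝ) • w := by
  funext s
  rw [iteratedDeriv_succ, iteratedDeriv_one, deriv_quadraticCurve]
  simpa using ((((hasDerivAt_id' s).const_mul 2).smul_const w).const_add v).deriv

theorem iteratedDeriv_two_comp_line (hf : ContDiffAt ℝ 2 f a) (v : E) :
    iteratedDeriv 2 (fun s : ℝ => f (a + s • v)) 0 = iteratedFDeriv ℝ 2 f a ![v, v] := by
  have h0 : a + (0 : ℝ) • v + (0 : ℝ) ^ 2 • (0 : E) = a := by simp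
  have h := iteratedDeriv_vcomp_two (f := fun s : ℝ => a + s • v + s ^ 2 • (0 : E)) (x := 0)
    (h0.symm ▸ hf) (by fun_prop)
  rw [h0, deriv_quadraticCurve, iteratedDeriv_two_quadraticCurve] at h
  simpa [Function.comp_def, iteratedFDeriv_two_apply] using h

theorem iteratedDeriv_three_comp_quadraticCurve (hf : ContDiffAt ℝ 3 f a) (v w : E) :
    iteratedDeriv 3 (fun s : ℝ => f (a + s • v + s ^ 2 • w)) 0
      = iteratedFDeriv ℝ 3 f a ![v, v, v] + (6 : ℝ) • iteratedFDeriv ℝ 2 f a ![v, w] := by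
  have h0 : a + (0 : ℝ) • v + (0 : ℝ) ^ 2 • w = a := by simp
  have h3 : iteratedDeriv 3 (fun s : ℝ => a + s • v + s ^ 2 • w) 0 = 0 := by
    rw [iteratedDeriv_succ, iteratedDeriv_two_quadraticCurve, deriv_const]
  have hsymm : fderiv ℝ (fderiv ℝ f) a w v = fderiv ℝ (fderiv ℝ f) a v w :=
    hf.isSymmSndFDerivAt (by rw [minSmoothness_of_isRCLikeNormedField]; norm_num) w v
  have h := iteratedDeriv_vcomp_three (f := fun s : ℝ => a + s • v + s ^ 2 • w) (x := 0)
    (h0.symm ▸ hf) (by fun_prop)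
  rw [h0, deriv_quadraticCurve, iteratedDeriv_two_quadraticCurve, h3] at h
  have hv : (fun _ => v : Fin 3 → E) = ![v, v, v] := by
    funext i; fin_cases i <;> rfl
  simp only [Function.comp_def, mul_zero, zero_smul, add_zero, hv, iteratedFDeriv_two_apply,
    Matrix.cons_val_zero, Matrix.cons_val_one, map_smul, smul_apply, hsymm,
    map_zero] at h
  rw [h, iteratedFDeriv_two_apply]
  simp only [Matrix.cons_val_zero, Matrix.cons_val_one]
  module

end Taylor

section Laplacian

open InnerProductSpace
open scoped Laplacian

/-- `f` is of class `C²` at `z`, where its Laplacian has the value `l`. -/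
def HasLaplacianAt {E : Type*} [NormedAddCommGroup E] [InnerProductSpace ℝ E]
    [FiniteDimensional ℝ E] (f : E → ℝ) (l : ℝ) (z : E) : Prop :=
  ContDiffAt ℝ 2 f z ∧ Δ f z = l

namespace HasLaplacianAt

variable {E : Type*} [NormedAddCommGroup E] [InnerProductSpace ℝ E] [FiniteDimensional ℝ E]
  {f g : E → ℝ} {l l' : ℝ} {z : E}

theorem add (hf : HasLaplacianAt f l z) (hg : HasLaplacianAt g l' z) :
    HasLaplacianAt (fun w => f w + g w) (l + l') z :=
  ⟨hf.1.add hg.1, (hf.1.laplacian_add hg.1).trans (by rw [hf.2, hg.2])⟩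

theorem sub (hf : HasLaplacianAt f l z) (hg : HasLaplacianAt g l' z) :
    HasLaplacianAt (fun w => f w - g w) (l - l') z :=
  ⟨hf.1.sub hg.1, (hf.1.laplacian_sub hg.1).trans (by rw [hf.2, hg.2])⟩

theorem const_mul (c : ℝ) (hf : HasLaplacianAt f l z) :
    HasLaplacianAt (fun w => c * f w) (c * l) z :=
  ⟨hf.1.const_smul c, (laplacian_smul c hf.1).trans (by rw [hf.2, smul_eq_mul])⟩

end HasLaplacianAt

theorem hasLaplacianAt_comp_norm_sq {E : Type*} [NormedAddCommGroup E] [InnerProductSpace ℝ E]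
    [FiniteDimensional ℝ E] {φ : ℝ → ℝ} {c z : E} (hφ : ContDiffAt ℝ 2 φ (‖z + c‖ ^ 2)) :
    HasLaplacianAt (fun w => φ (‖w + c‖ ^ 2)) (2 * Module.finrank ℝ E * deriv φ (‖z + c‖ ^ 2)
      + 4 * ‖z + c‖ ^ 2 * iteratedDeriv 2 φ (‖z + c‖ ^ 2)) z := by
  let b := stdOrthonormalBasis ℝ E
  have hf : ContDiffAt ℝ 2 (fun w => φ (‖w + c‖ ^ 2)) z :=
    hφ.comp (f := fun w : E => ‖w + c‖ ^ 2) z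
      ((contDiff_norm_sq ℝ).contDiffAt.comp z (by fun_prop))
  have hline (i) : iteratedFDeriv ℝ 2 (fun w => φ (‖w + c‖ ^ 2)) z ![b i, b i]
      = 2 * deriv φ (‖z + c‖ ^ 2)
        + 4 * iteratedDeriv 2 φ (‖z + c‖ ^ 2) * inner ℝ (b i) (z + c) ^ 2 := by
    have hnorm (s : ℝ) : ‖z + s • b i + c‖ ^ 2
        = ‖z + c‖ ^ 2 + s • (2 * inner ℝ (b i) (z + c)) + s ^ 2 • 1 := by
      rw [add_right_comm, norm_add_sq_real, norm_smul, b.norm_eq_one, real_inner_smul_right,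
        real_inner_comm, mul_one, Real.norm_eq_abs, sq_abs]
      simp only [smul_eq_mul]
      ring
    rw [← iteratedDeriv_two_comp_line hf]
    simp only [hnorm]
    refine (iteratedDeriv_comp_two (g := φ) (f := fun s : ℝ => ‖z + c‖ ^ 2
      + s • (2 * inner ℝ (b i) (z + c)) + s ^ 2 • (1 : ℝ)) (by simpa using hφ)
      (by fun_prop)).trans ?_
    rw [deriv_quadraticCurve, iteratedDeriv_two_quadraticCurve]
    simp only [add_zero, smul_eq_mul, mul_zero, zero_mul, mul_one, ne_eq,
      OfNat.ofNat_ne_zero, not_false_eq_true, zero_pow]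
    ring
  refine ⟨hf, ?_⟩
  rw [laplacian_eq_iteratedFDeriv_orthonormalBasis _ b]
  simp only [hline, Finset.sum_add_distrib, ← Finset.mul_sum, Finset.sum_const, Finset.card_univ,
    Fintype.card_fin, nsmul_eq_mul, b.sum_sq_inner_right]
  ring

theorem hasLaplacianAt_norm_sq {E : Type*} [NormedAddCommGroup E] [InnerProductSpace ℝ E]
    [FiniteDimensional ℝ E] (z : E) :
    HasLaplacianAt (fun w => ‖w‖ ^ 2) (2 * Module.finrank ℝ E) z := by
  simpa [iteratedDeriv_fun_id] using
    hasLaplacianAt_comp_norm_sq (φ := fun t => t) (c := 0) (z := z) contDiffAt_fun_id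

theorem hasLaplacianAt_norm_rpow {c z : ℂ} (h : z + c ≠ 0) (p : ℝ) :
    HasLaplacianAt (fun w : ℂ => ‖w + c‖ ^ p) (p ^ 2 * ‖z + c‖ ^ (p - 2)) z := by
  have hpow (w : ℂ) (r : ℝ) : (‖w‖ ^ 2) ^ (r / 2) = ‖w‖ ^ r := by
    rw [← Real.rpow_natCast_mul (norm_nonneg _)]
    congr 1
    push_cast
    ring
  have hpos : 0 < ‖z + c‖ ^ 2 := by positivity
  have hderiv₂ (t : ℝ) :
      iteratedDeriv 2 (fun t : ℝ => t ^ (p / 2)) t = p / 2 * ((p / 2 - 1) * t ^ (p / 2 - 2)) := by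
    rw [iteratedDeriv_succ, iteratedDeriv_one, Real.deriv_rpow_const', deriv_const_mul_field,
      Real.deriv_rpow_const, sub_sub]
    norm_num
  have h₁ : p / 2 - 1 = (p - 2) / 2 := by ring
  have h₂ : ‖z + c‖ ^ 2 * (‖z + c‖ ^ 2) ^ (p / 2 - 2) = ‖z + c‖ ^ (p - 2) := by
    rw [← hpow, ← h₁, mul_comm, ← Real.rpow_add_one hpos.ne']
    ring_nf
  have hlap := hasLaplacianAt_comp_norm_sq (φ := fun t => t ^ (p / 2)) (c := c) (z := z)
    (Real.contDiffAt_rpow_const_of_ne hpos.ne')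
  simp only [hpow] at hlap
  convert hlap using 1
  rw [hderiv₂, Real.deriv_rpow_const, h₁, hpow, Complex.finrank_real_complex]
  linear_combination -p * (p - 2) * h₂

theorem harmonicAt_arctan_im_div_re {g : ℂ → ℂ} {z : ℂ} (hg : AnalyticAt ℂ g z)
    (hre : (g z).re ≠ 0) : HarmonicAt (fun w => Real.arctan ((g w).im / (g w).re)) z := by
  wlog hpos : 0 < (g z).re generalizing g
  · have hneg := this hg.neg (by simpa using hre)
      (by simpa using lt_of_le_of_ne (not_lt.mp hpos) hre)
    simpa only [Pi.neg_apply, Complex.neg_im, Complex.neg_re, neg_div_neg_eq] using hneg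
  have hlog := (hg.clog (Or.inl hpos)).harmonicAt_im
  refine (harmonicAt_congr_nhds ?_).mp hlog
  have hev : ∀ᶠ w in 𝓝 z, 0 < (g w).re :=
    (Complex.continuous_re.continuousAt.comp hg.continuousAt).eventually (lt_mem_nhds hpos)
  filter_upwards [hev] with w hw
  rw [Complex.log_im, ← Complex.tan_arg, Real.arctan_tan]
  · exact (abs_lt.mp (Complex.abs_arg_lt_pi_div_two_iff.mpr (Or.inl hw))).1
  · exact (abs_lt.mp (Complex.abs_arg_lt_pi_div_two_iff.mpr (Or.inl hw))).2

theorem hasLaplacianAt_arctan_im_div_re {g : ℂ → ℂ} {z : ℂ} (hg : AnalyticAt ℂ g z)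
    (hre : (g z).re ≠ 0) :
    HasLaplacianAt (fun w => Real.arctan ((g w).im / (g w).re)) 0 z :=
  ⟨(harmonicAt_arctan_im_div_re hg hre).1, (harmonicAt_arctan_im_div_re hg hre).2.eq_of_nhds⟩

end Laplacian

section BinaryCubic

/-- The binary cubic form `c₀x³ + 3c₁x²y + 3c₂xy² + c₃y³` with coefficients `c`. The binomial
factors make its polarization free of constants. -/
def binaryCubic (c : Fin 4 → ℝ) (x y : ℝ) : ℝ :=
  c 0 * x ^ 3 + 3 * c 1 * x ^ 2 * y + 3 * c 2 * x * y ^ 2 + c 3 * y ^ 3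

/-- The partial derivative in `x` of `binaryCubic c`. -/
def binaryCubicX (c : Fin 4 → ℝ) (x y : ℝ) : ℝ :=
  3 * (c 0 * x ^ 2 + 2 * c 1 * x * y + c 2 * y ^ 2)

/-- The partial derivative in `y` of `binaryCubic c`. -/
def binaryCubicY (c : Fin 4 → ℝ) (x y : ℝ) : ℝ :=
  3 * (c 1 * x ^ 2 + 2 * c 2 * x * y + c 3 * y ^ 2)

variable {f g : ℝ → ℝ} {f' g' t : ℝ}

theorem hasDerivAt_binaryCubic (c : Fin 4 → ℝ) (hf : HasDerivAt f f' t)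
    (hg : HasDerivAt g g' t) :
    HasDerivAt (fun s => binaryCubic c (f s) (g s))
      (binaryCubicX c (f t) (g t) * f' + binaryCubicY c (f t) (g t) * g') t := by
  refine ((((hf.fun_pow 3).const_mul (c 0)).fun_add
    (((hf.fun_pow 2).const_mul (3 * c 1)).fun_mul hg)).fun_add
    ((hf.const_mul (3 * c 2)).fun_mul (hg.fun_pow 2))).fun_add
    ((hg.fun_pow 3).const_mul (c 3)) |>.congr_deriv ?_
  rw [binaryCubicX, binaryCubicY]
  push_cast
  ring

theorem hasDerivAt_binaryCubicX (c : Fin 4 → ℝ) (hf : HasDerivAt f f' t)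
    (hg : HasDerivAt g g' t) :
    HasDerivAt (fun s => binaryCubicX c (f s) (g s))
      (6 * ((c 0 * f t + c 1 * g t) * f' + (c 1 * f t + c 2 * g t) * g')) t := by
  refine ((((hf.fun_pow 2).const_mul (c 0)).fun_add ((hf.const_mul (2 * c 1)).fun_mul hg)).fun_add
    ((hg.fun_pow 2).const_mul (c 2))).const_mul 3 |>.congr_deriv ?_
  push_cast
  ring

theorem hasDerivAt_binaryCubicY (c : Fin 4 → ℝ) (hf : HasDerivAt f f' t)
    (hg : HasDerivAt g g' t) :
    HasDerivAt (fun s => binaryCubicY c (f s) (g s))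
      (6 * ((c 1 * f t + c 2 * g t) * f' + (c 2 * f t + c 3 * g t) * g')) t := by
  refine ((((hf.fun_pow 2).const_mul (c 1)).fun_add ((hf.const_mul (2 * c 2)).fun_mul hg)).fun_add
    ((hg.fun_pow 2).const_mul (c 3))).const_mul 3 |>.congr_deriv ?_
  push_cast
  ring

end BinaryCubic

section CubicTaylor

open scoped ContDiff

/-- The coefficients, in the convention of `binaryCubic`, of the cubic part of the Taylor expansion
at `a` of a function on the plane `ℂ`, with respect to the basis `1, i`. -/
noncomputable def cubicTaylorCoeff (f : ℂ → ℝ) (a : ℂ) : Fin 4 → ℝ :=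
  ![iteratedFDeriv ℝ 3 f a ![1, 1, 1] / 6, iteratedFDeriv ℝ 3 f a ![1, 1, Complex.I] / 6,
    iteratedFDeriv ℝ 3 f a ![1, Complex.I, Complex.I] / 6,
    iteratedFDeriv ℝ 3 f a ![Complex.I, Complex.I, Complex.I] / 6]

theorem iteratedFDeriv_two_complex_apply {f : ℂ → ℝ} {a : ℂ} (hf : ContDiffAt ℝ 2 f a) (v w : ℂ) :
    iteratedFDeriv ℝ 2 f a ![v, w] = v.re * w.re * iteratedFDeriv ℝ 2 f a ![1, 1]
      + (v.re * w.im + v.im * w.re) * iteratedFDeriv ℝ 2 f a ![1, Complex.I]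
      + v.im * w.im * iteratedFDeriv ℝ 2 f a ![Complex.I, Complex.I] := by
  have hsymm := hf.isSymmSndFDerivAt (by simp) Complex.I 1
  have hz (z : ℂ) : z = z.re • 1 + z.im • Complex.I := by
    simp [Complex.real_smul, Complex.re_add_im]
  simp only [iteratedFDeriv_two_apply, Matrix.cons_val_zero, Matrix.cons_val_one]
  conv_lhs => rw [hz v, hz w]
  simp only [map_add, map_smul, add_apply, smul_apply, smul_eq_mul, hsymm]
  ring

theorem iteratedFDeriv_three_swap_left {E F : Type*} [NormedAddCommGroup E] [NormedSpace ℝ E]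
    [NormedAddCommGroup F] [NormedSpace ℝ F] {f : E → F} {a : E} (hf : ContDiffAt ℝ ω f a)
    (u v w : E) : iteratedFDeriv ℝ 3 f a ![v, u, w] = iteratedFDeriv ℝ 3 f a ![u, v, w] := by
  rw [← hf.iteratedFDeriv_comp_perm ![u, v, w] (Equiv.swap 0 1)]
  congr 1
  funext i
  fin_cases i <;> rfl

theorem iteratedFDeriv_three_swap_right {E F : Type*} [NormedAddCommGroup E] [NormedSpace ℝ E]
    [NormedAddCommGroup F] [NormedSpace ℝ F] {f : E → F} {a : E} (hf : ContDiffAt ℝ ω f a)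
    (u v w : E) : iteratedFDeriv ℝ 3 f a ![u, w, v] = iteratedFDeriv ℝ 3 f a ![u, v, w] := by
  rw [← hf.iteratedFDeriv_comp_perm ![u, v, w] (Equiv.swap 1 2)]
  congr 1
  funext i
  fin_cases i <;> rfl

theorem iteratedFDeriv_three_complex_apply {f : ℂ → ℝ} {a : ℂ} (hf : ContDiffAt ℝ ω f a)
    (v w : ℂ) :
    iteratedFDeriv ℝ 3 f a ![v, v, w]
      = 2 * (binaryCubicX (cubicTaylorCoeff f a) v.re v.im * w.re
        + binaryCubicY (cubicTaylorCoeff f a) v.re v.im * w.im) := by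
  have hnested (u v w : ℂ) :
      iteratedFDeriv ℝ 3 f a ![u, v, w] = fderiv ℝ (fderiv ℝ (fderiv ℝ f)) a u v w := by
    simp [iteratedFDeriv_succ_apply_right (n := 2), iteratedFDeriv_two_apply, Fin.init]
  have hswap_left := iteratedFDeriv_three_swap_left hf
  have hswap_right := iteratedFDeriv_three_swap_right hf
  simp only [binaryCubicX, binaryCubicY, cubicTaylorCoeff, hnested] at *
  have hz (z : ℂ) : z = z.re • 1 + z.im • Complex.I := by
    simp [Complex.real_smul, Complex.re_add_im]
  conv_lhs => rw [hz v, hz w]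
  simp only [map_add, map_smul, add_apply, smul_apply, smul_eq_mul, Matrix.cons_val,
    hswap_left 1 Complex.I, hswap_right _ 1 Complex.I]
  ring

theorem iteratedFDeriv_three_complex_diag {f : ℂ → ℝ} {a : ℂ} (hf : ContDiffAt ℝ ω f a) (v : ℂ) :
    iteratedFDeriv ℝ 3 f a ![v, v, v] = 6 * binaryCubic (cubicTaylorCoeff f a) v.re v.im := by
  rw [iteratedFDeriv_three_complex_apply hf, binaryCubicX, binaryCubicY, binaryCubic]
  ring

end CubicTaylor

theorem iteratedDeriv_two_fderiv_comp_line {E F : Type*} [NormedAddCommGroup E] [NormedSpace ℝ E]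
    [NormedAddCommGroup F] [NormedSpace ℝ F] {f : E → F} {a : E} (hf : ContDiffAt ℝ 3 f a)
    (v w : E) :
    iteratedDeriv 2 (fun s : ℝ => fderiv ℝ f (a + s • v) w) 0
      = iteratedFDeriv ℝ 3 f a ![v, v, w] := by
  have hf' : ContDiffAt ℝ 2 (fderiv ℝ f) a := hf.fderiv_right (by norm_num)
  have happly := (ContinuousLinearMap.apply ℝ F w).iteratedFDeriv_comp_left hf' (i := 2) le_rfl
  rw [iteratedDeriv_two_comp_line (f := fun z => fderiv ℝ f z w) (hf'.clm_apply contDiffAt_const),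
    iteratedFDeriv_succ_apply_right (n := 2)]
  have hinit : Fin.init ![v, v, w] = ![v, v] := by
    funext i
    fin_cases i <;> rfl
  rw [hinit]
  exact DFunLike.congr_fun happly ![v, v]

theorem iteratedDeriv_succ_id_mul_zero {g : ℝ → ℝ} {n : ℕ} (hg : ContDiffAt ℝ (n + 1) g 0) :
    iteratedDeriv (n + 1) (fun s => s * g s) 0 = (n + 1) * iteratedDeriv n g 0 := by
  rw [iteratedDeriv_fun_mul contDiffAt_fun_id hg, Finset.sum_eq_single 1]
  · simp
  · intro i _ hi
    rcases i with _ | _ | i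
    · simp
    · simp at hi
    · simp [iteratedDeriv_fun_id]
  · simp

theorem iteratedDeriv_three_add_id_mul {f g : ℝ → ℝ} (hf : ContDiffAt ℝ 3 f 0)
    (hg : ContDiffAt ℝ 3 g 0) (a b : ℝ) :
    iteratedDeriv 3 (fun s => f s + s * (a + (s * b + g s))) 0
      = iteratedDeriv 3 f 0 + 3 * iteratedDeriv 2 g 0 := by
  have hlin : iteratedDeriv 2 (fun s : ℝ => s * b) 0 = 0 := by
    rw [iteratedDeriv_succ_id_mul_zero contDiffAt_const, iteratedDeriv_const]
    simp
  rw [iteratedDeriv_fun_add hf (by fun_prop), iteratedDeriv_succ_id_mul_zero (by fun_prop),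
    iteratedDeriv_const_add two_pos, iteratedDeriv_fun_add (by fun_prop)
      (hg.of_le (by norm_num)), hlin]
  norm_num

theorem iteratedDeriv_three_sq_linear_add_sq (p q : ℝ) :
    iteratedDeriv 3 (fun s : ℝ => (s * p + s ^ 2 * q) ^ 2 / 2) 0 = 6 * (p * q) := by
  have hfactor (s : ℝ) : (s * p + s ^ 2 * q) ^ 2 / 2 = s * (s * ((p + s * q) ^ 2 / 2)) := by ring
  have hderiv : HasDerivAt (fun s : ℝ => (p + s * q) ^ 2 / 2) (p * q) 0 :=
    (((((hasDerivAt_id' 0).mul_const q).const_add p).fun_pow 2).div_const 2).congr_deriv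
      (by push_cast; ring)
  simp only [hfactor]
  rw [iteratedDeriv_succ_id_mul_zero (by fun_prop), iteratedDeriv_succ_id_mul_zero (by fun_prop),
    iteratedDeriv_one, hderiv.deriv]
  push_cast
  ring

theorem contDiffAt_norm_add_rpow {E : Type*} [NormedAddCommGroup E] [InnerProductSpace ℝ E]
    {n : WithTop ℕ∞} {c z : E} (h : z + c ≠ 0) (p : ℝ) :
    ContDiffAt ℝ n (fun w => ‖w + c‖ ^ p) z :=
  ((contDiffAt_norm ℝ h).comp z (by fun_prop)).rpow_const_of_ne (by simpa using h)

namespace PRModel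

section LagrangianExpansion

open scoped ContDiff

variable {M : PRModel}

/-- The point `(xs, ys)` of the plane, which is identified with `ℂ`. -/
def zs (M : PRModel) : ℂ := ⟨M.xs, M.ys⟩

/-- The velocity-independent part of the Lagrangian. -/
noncomputable def V (M : PRModel) (z : ℂ) : ℝ := M.L z.re z.im 0 0

/-- The gauge function of the drag: its derivative along the motion is the part of the drag term
of the Lagrangian that is linear in the velocity. -/
noncomputable def S (M : PRModel) (z : ℂ) : ℝ := M.W₁ / 2 * Real.log ‖z + M.μ‖

theorem norm_add_μ (M : PRModel) (z : ℂ) : ‖z + M.μ‖ = M.r₁ z.re z.im := by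
  rw [r₁, Complex.norm_eq_sqrt_sq_add_sq]
  simp

theorem norm_add_μ_sub_one (M : PRModel) (z : ℂ) : ‖z + (M.μ - 1 : ℝ)‖ = M.r₂ z.re z.im := by
  rw [r₂, Complex.norm_eq_sqrt_sq_add_sq]
  simp [add_sub_assoc]

theorem fderiv_S {z : ℂ} (hz : z + M.μ ≠ 0) (w : ℂ) :
    fderiv ℝ M.S z w
      = M.W₁ * ((z.re + M.μ) * w.re + z.im * w.im) / (2 * M.r₁ z.re z.im ^ 2) := by
  have hS : M.S = fun z : ℂ => M.W₁ / 4 * Real.log (‖z + M.μ‖ ^ 2) := by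
    funext z
    rw [S, Real.log_pow]
    push_cast
    ring
  have hshift : HasFDerivAt (fun z : ℂ => z + (M.μ : ℂ)) (.id ℝ ℂ) z :=
    (hasFDerivAt_id z).add_const _
  rw [hS, ((hshift.norm_sq.log (by positivity)).const_mul (M.W₁ / 4)).fderiv]
  simp only [map_add, ContinuousLinearMap.comp_id, smul_add, add_apply, smul_apply,
    coe_innerSL_apply, Complex.inner, Complex.mul_re, Complex.conj_re, Complex.conj_im, mul_neg,
    sub_neg_eq_add, nsmul_eq_mul, Nat.cast_ofNat, smul_eq_mul, Complex.conj_ofReal,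
    Complex.ofReal_re, Complex.ofReal_im, mul_zero, sub_zero, ← norm_add_μ]
  field_simp
  ring

theorem L_eq {z : ℂ} (hz : z + M.μ ≠ 0) (w : ℂ) :
    M.L z.re z.im w.re w.im
      = ‖w‖ ^ 2 / 2 + M.n * (z.re * w.im - w.re * z.im) + M.V z + fderiv ℝ M.S z w := by
  rw [fderiv_S hz, V, L, L, ← Complex.normSq_eq_norm_sq, Complex.normSq_apply]
  ring

theorem H_eq (M : PRModel) (z w : ℂ) : M.H z.re z.im w.re w.im = ‖w‖ ^ 2 / 2 - M.V z := by
  have hquad (p q t : ℝ) : deriv (fun t => t ^ 2 / 2 + p * t + q) t = t + p := by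
    refine HasDerivAt.deriv (((((hasDerivAt_pow 2 t).div_const 2).fun_add
      ((hasDerivAt_id' t).const_mul p)).add_const q).congr_deriv ?_)
    push_cast
    ring
  have hpx : M.px z.re z.im w.re w.im = w.re
      + (M.W₁ * ((z.re + M.μ) / (2 * M.r₁ z.re z.im ^ 2)) - M.n * z.im) := by
    rw [← hquad _ (M.L z.re z.im 0 w.im), px]
    congr 1
    funext t
    simp only [L]
    ring
  have hpy : M.py z.re z.im w.re w.im = w.im
      + (M.W₁ * (z.im / (2 * M.r₁ z.re z.im ^ 2)) + M.n * z.re) := by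
    rw [← hquad _ (M.L z.re z.im w.re 0), py]
    congr 1
    funext t
    simp only [L]
    ring
  rw [H, hpx, hpy, V, L, L, ← Complex.normSq_eq_norm_sq, Complex.normSq_apply]
  ring

theorem V_eq (M : PRModel) (z : ℂ) : M.V z = M.n ^ 2 / 2 * ‖z‖ ^ 2
    + (1 - M.μ) * M.q₁ * ‖z + M.μ‖ ^ (-1 : ℝ) + M.μ * ‖z + (M.μ - 1 : ℝ)‖ ^ (-1 : ℝ)
    + M.μ * M.A₂ / 2 * ‖z + (M.μ - 1 : ℝ)‖ ^ (-3 : ℝ)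
    - M.W₁ * M.n * Real.arctan ((z + M.μ).im / (z + M.μ).re) := by
  have hpow : M.r₂ z.re z.im ^ (-3 : ℝ) = (M.r₂ z.re z.im ^ 3)⁻¹ := by
    rw [Real.rpow_neg (show 0 ≤ M.r₂ z.re z.im from Real.sqrt_nonneg _)]
    norm_cast
  rw [norm_add_μ, norm_add_μ_sub_one, V, L, Real.rpow_neg_one, Real.rpow_neg_one, hpow,
    ← Complex.normSq_eq_norm_sq, Complex.normSq_apply, Complex.add_im,
    Complex.ofReal_im, Complex.add_re, Complex.ofReal_re]
  ring_nf

theorem add_μ_ne_zero {z : ℂ} (hz : z.re + M.μ ≠ 0) : z + M.μ ≠ 0 :=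
  fun h => hz (by simpa using congrArg Complex.re h)

theorem contDiffAt_S {z : ℂ} {n : WithTop ℕ∞} (hz : z + M.μ ≠ 0) : ContDiffAt ℝ n M.S z :=
  contDiffAt_const.mul (((contDiffAt_norm ℝ hz).comp z (by fun_prop)).log (by simpa using hz))

theorem contDiffAt_V {z : ℂ} {n : WithTop ℕ∞} (h₁ : z.re + M.μ ≠ 0)
    (h₂ : z + (M.μ - 1 : ℝ) ≠ 0) : ContDiffAt ℝ n M.V z := by
  have hshift : ContDiff ℝ n (fun w : ℂ => w + M.μ) := by fun_prop
  have harctan : ContDiffAt ℝ n (fun w : ℂ => Real.arctan ((w + M.μ).im / (w + M.μ).re)) z :=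
    Real.contDiff_arctan.contDiffAt.comp z ((Complex.imCLM.contDiff.comp hshift).contDiffAt.div
      (Complex.reCLM.contDiff.comp hshift).contDiffAt (by simpa using h₁))
  refine ContDiffAt.congr_of_eventuallyEq ?_ (.of_forall M.V_eq)
  exact ((((contDiffAt_const.mul (contDiff_norm_sq ℝ).contDiffAt).add
    (contDiffAt_const.mul (contDiffAt_norm_add_rpow (add_μ_ne_zero h₁) _))).add
    (contDiffAt_const.mul (contDiffAt_norm_add_rpow h₂ _))).add
    (contDiffAt_const.mul (contDiffAt_norm_add_rpow h₂ _))).sub (contDiffAt_const.mul harctan)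

theorem hasLaplacianAt_V {z : ℂ} (h₁ : z.re + M.μ ≠ 0) (h₂ : z + (M.μ - 1 : ℝ) ≠ 0) :
    HasLaplacianAt M.V (2 * M.n ^ 2 + (1 - M.μ) * M.q₁ * ‖z + M.μ‖ ^ (-3 : ℝ)
      + M.μ * ‖z + (M.μ - 1 : ℝ)‖ ^ (-3 : ℝ)
      + 9 / 2 * M.μ * M.A₂ * ‖z + (M.μ - 1 : ℝ)‖ ^ (-5 : ℝ)) z := by
  have hz := add_μ_ne_zero h₁
  have harctan := hasLaplacianAt_arctan_im_div_re (g := fun w => w + M.μ) (z := z)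
    (by fun_prop) (by simpa using h₁)
  have hsum := (((((hasLaplacianAt_norm_sq z).const_mul (M.n ^ 2 / 2)).add
    ((hasLaplacianAt_norm_rpow hz (-1)).const_mul ((1 - M.μ) * M.q₁))).add
    ((hasLaplacianAt_norm_rpow h₂ (-1)).const_mul M.μ)).add
    ((hasLaplacianAt_norm_rpow h₂ (-3)).const_mul (M.μ * M.A₂ / 2))).sub
    (harctan.const_mul (M.W₁ * M.n))
  rw [funext M.V_eq]
  convert hsum using 1
  norm_num [Complex.finrank_real_complex]
  ring

theorem Lpart_two_zero_velocity (hV : ContDiffAt ℝ 2 M.V M.zs) (x y : ℝ) :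
    M.Lpart 2 x y 0 0 = iteratedFDeriv ℝ 2 M.V M.zs ![⟨x, y⟩, ⟨x, y⟩] / 2 := by
  rw [← iteratedDeriv_two_comp_line hV]
  simp [Lpart, V, zs]

theorem iteratedFDeriv_two_V (hV : ContDiffAt ℝ 2 M.V M.zs) (v w : ℂ) :
    iteratedFDeriv ℝ 2 M.V M.zs ![v, w] = (M.n ^ 2 - 2 * M.E) * (v.re * w.re)
      - M.G * (v.re * w.im + v.im * w.re) + (M.n ^ 2 - 2 * M.F) * (v.im * w.im) := by
  have hLpart (x y : ℝ) : M.Lpart 2 x y 0 0 = (x * x * iteratedFDeriv ℝ 2 M.V M.zs ![1, 1]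
      + (x * y + y * x) * iteratedFDeriv ℝ 2 M.V M.zs ![1, Complex.I]
      + y * y * iteratedFDeriv ℝ 2 M.V M.zs ![Complex.I, Complex.I]) / 2 := by
    rw [Lpart_two_zero_velocity hV, iteratedFDeriv_two_complex_apply hV]
  rw [iteratedFDeriv_two_complex_apply hV v w]
  simp only [G, E, F, hLpart]
  ring

theorem E_add_F_lt (hμ₀ : 0 ≤ M.μ) (hμ₁ : M.μ ≤ 1) (hq : 0 ≤ M.q₁) (hA : 0 ≤ M.A₂)
    (h₁ : M.xs + M.μ ≠ 0) (h₂ : M.r₂ M.xs M.ys ≠ 0) : M.E + M.F < M.n ^ 2 := by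
  have h₂' : M.zs + (M.μ - 1 : ℝ) ≠ 0 := by
    rwa [← norm_ne_zero_iff, norm_add_μ_sub_one]
  obtain ⟨hV, hΔ⟩ := hasLaplacianAt_V (z := M.zs) h₁ h₂'
  rw [InnerProductSpace.laplacian_eq_iteratedFDeriv_complexPlane] at hΔ
  simp only [iteratedFDeriv_two_V hV, Complex.one_re, Complex.one_im, Complex.I_re,
    Complex.I_im] at hΔ
  have hn : 0 < M.n ^ 2 := pow_pos (Real.sqrt_pos.mpr (by positivity)) 2
  have : 0 ≤ 1 - M.μ := sub_nonneg.mpr hμ₁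
  have hattraction : 0 ≤ (1 - M.μ) * M.q₁ * ‖M.zs + M.μ‖ ^ (-3 : ℝ)
      + M.μ * ‖M.zs + (M.μ - 1 : ℝ)‖ ^ (-3 : ℝ)
      + 9 / 2 * M.μ * M.A₂ * ‖M.zs + (M.μ - 1 : ℝ)‖ ^ (-5 : ℝ) := by positivity
  linarith

theorem L_line_eventuallyEq (hz : M.zs + M.μ ≠ 0) (z w : ℂ) :
    (fun s : ℝ => M.L (M.xs + s * z.re) (M.ys + s * z.im) (s * w.re) (s * w.im))
      =ᶠ[𝓝 0] fun s => M.V (M.zs + s • z) + s * (M.n * (M.xs * w.im - w.re * M.ys)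
        + (s * (‖w‖ ^ 2 / 2 + M.n * (z.re * w.im - w.re * z.im))
          + fderiv ℝ M.S (M.zs + s • z) w)) := by
  have hne : ∀ᶠ s : ℝ in 𝓝 0, M.zs + s • z + M.μ ≠ 0 :=
    (show Continuous fun s : ℝ => M.zs + s • z + M.μ by fun_prop).continuousAt.eventually_ne
      (by simpa using hz)
  filter_upwards [hne] with s hs
  have hL := L_eq hs (s • w)
  simp only [map_smul, norm_smul, mul_pow, Real.norm_eq_abs, sq_abs, smul_eq_mul, Complex.add_re,
    Complex.add_im, Complex.smul_re, Complex.smul_im] at hL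
  refine hL.trans ?_
  simp only [zs]
  ring

theorem Lpart_three (hz : M.zs + M.μ ≠ 0) (hV : ContDiffAt ℝ ω M.V M.zs) (x y u v : ℝ) :
    M.Lpart 3 x y u v = binaryCubic (cubicTaylorCoeff M.V M.zs) x y
      + binaryCubicX (cubicTaylorCoeff M.S M.zs) x y * u
      + binaryCubicY (cubicTaylorCoeff M.S M.zs) x y * v := by
  let z : ℂ := ⟨x, y⟩
  let w : ℂ := ⟨u, v⟩
  have hline {f : ℂ → ℝ} (hf : ContDiffAt ℝ ω f M.zs) :
      ContDiffAt ℝ 3 (fun s : ℝ => f (M.zs + s • z)) 0 :=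
    ContDiffAt.fun_comp 0 (by simpa using hf.of_le le_top) (by fun_prop)
  have hS : ContDiffAt ℝ ω M.S M.zs := contDiffAt_S hz
  have hdS : ContDiffAt ℝ ω (fun z => fderiv ℝ M.S z w) M.zs :=
    (hS.fderiv_right le_top).clm_apply contDiffAt_const
  have hV₃ : iteratedDeriv 3 (fun s : ℝ => M.V (M.zs + s • z)) 0
      = 6 * binaryCubic (cubicTaylorCoeff M.V M.zs) x y := by
    simpa [iteratedFDeriv_three_complex_diag hV, iteratedFDeriv_two_V (hV.of_le le_top), z] using
      iteratedDeriv_three_comp_quadraticCurve (hV.of_le le_top) z 0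
  rw [Lpart, (L_line_eventuallyEq hz z w).iteratedDeriv_eq,
    iteratedDeriv_three_add_id_mul (hline hV) (hline hdS), hV₃,
    iteratedDeriv_two_fderiv_comp_line (hS.of_le le_top), iteratedFDeriv_three_complex_apply hS]
  simp only [Nat.factorial, z, w]
  push_cast
  ring

theorem iteratedDeriv_three_H (hV : ContDiffAt ℝ ω M.V M.zs) (x y u v x' y' u' v' : ℝ) :
    iteratedDeriv 3 (fun s : ℝ => M.H (M.xs + (s * x + s ^ 2 * x')) (M.ys + (s * y + s ^ 2 * y'))
      (s * u + s ^ 2 * u') (s * v + s ^ 2 * v')) 0 / (Nat.factorial 3 : ℝ) =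
      u * u' + v * v' - binaryCubic (cubicTaylorCoeff M.V M.zs) x y
        - ((M.n ^ 2 - 2 * M.E) * (x * x') - M.G * (x * y' + y * x')
          + (M.n ^ 2 - 2 * M.F) * (y * y')) := by
  let z : ℂ := ⟨x, y⟩
  let z' : ℂ := ⟨x', y'⟩
  have hH (s : ℝ) : M.H (M.xs + (s * x + s ^ 2 * x')) (M.ys + (s * y + s ^ 2 * y'))
      (s * u + s ^ 2 * u') (s * v + s ^ 2 * v')
      = (s * u + s ^ 2 * u') ^ 2 / 2 + (s * v + s ^ 2 * v') ^ 2 / 2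
        - M.V (M.zs + s • z + s ^ 2 • z') := by
    have h := M.H_eq (M.zs + s • z + s ^ 2 • z') ⟨s * u + s ^ 2 * u', s * v + s ^ 2 * v'⟩
    rw [← Complex.normSq_eq_norm_sq, Complex.normSq_apply] at h
    simp only [Complex.add_re, Complex.add_im, Complex.smul_re, Complex.smul_im, smul_eq_mul] at h
    rw [← add_assoc, ← add_assoc]
    refine h.trans ?_
    ring
  simp only [hH]
  rw [iteratedDeriv_fun_sub (by fun_prop), iteratedDeriv_fun_add (by fun_prop) (by fun_prop),
    iteratedDeriv_three_sq_linear_add_sq, iteratedDeriv_three_sq_linear_add_sq,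
    iteratedDeriv_three_comp_quadraticCurve (hV.of_le le_top),
    iteratedFDeriv_three_complex_diag hV, iteratedFDeriv_two_V (hV.of_le le_top)]
  · simp only [Nat.factorial, z, z', smul_eq_mul]
    push_cast
    ring
  · exact ContDiffAt.fun_comp 0 (by simpa using hV.of_le le_top) (by fun_prop)

end LagrangianExpansion

end PRModel

section FiniteRank

variable {K V W ι : Type*} [Field K] [AddCommGroup V] [Module K V] [AddCommGroup W] [Module K W]

theorem finiteDimensional_range_sum (s : Finset ι) {f : ι → V →ₗ[K] W}
    (hf : ∀ i ∈ s, FiniteDimensional K (LinearMap.range (f i))) :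
    FiniteDimensional K (LinearMap.range (∑ i ∈ s, f i)) := by
  have (i : s) : FiniteDimensional K (LinearMap.range (f i)) := hf i i.2
  refine Submodule.finiteDimensional_of_le (S₂ := ⨆ i : s, LinearMap.range (f i)) ?_
  rintro _ ⟨v, rfl⟩
  rw [LinearMap.sum_apply]
  exact sum_mem fun i hi => Submodule.mem_iSup_of_mem (⟨i, hi⟩ : s) ⟨v, rfl⟩

theorem map_eq_zero_of_map_apply_eq_zero {f : V →ₗ[K] W}
    [FiniteDimensional K (LinearMap.range f)] {A : V →ₗ[K] V}
    (hker : ∀ v, f v = 0 → f (A v) = 0) (hsurj : ∀ v, ∃ u, f (A u) = f v) {v : V}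
    (hv : f (A v) = 0) : f v = 0 := by
  have : FiniteDimensional K (V ⧸ LinearMap.ker f) := f.quotKerEquivRange.symm.finiteDimensional
  have hle : LinearMap.ker f ≤ (LinearMap.ker f).comap A := hker
  have hinj : Function.Injective ((LinearMap.ker f).mapQ (LinearMap.ker f) A hle) := by
    rw [LinearMap.injective_iff_surjective]
    rintro ⟨v⟩
    obtain ⟨u, hu⟩ := hsurj v
    refine ⟨Submodule.Quotient.mk u, (Submodule.Quotient.eq _).mpr ?_⟩
    rw [LinearMap.mem_ker, map_sub, hu, sub_self]
  rw [← LinearMap.mem_ker, ← Submodule.Quotient.mk_eq_zero]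
  refine hinj ?_
  rw [map_zero, Submodule.mapQ_apply, Submodule.Quotient.mk_eq_zero, LinearMap.mem_ker, hv]

end FiniteRank

section DAlembert

theorem ActionAngleFun.Agree.of_eq {f g : ActionAngleFun} (h : f = g) : f.Agree g :=
  fun _ _ _ _ _ _ => h ▸ rfl

theorem ActionAngleFun.Agree.symm {f g : ActionAngleFun} (h : f.Agree g) : g.Agree f :=
  fun _ _ _ _ hI₁ hI₂ => (h _ _ _ _ hI₁ hI₂).symm

/-- Arrays `(m, p, q) ↦ c m p q` of complex Fourier coefficients, with pointwise operations. -/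
abbrev FourierCoeff : Type := ℕ → ℕ → ℤ → ℂ

/-- The real wave `I₁^{a/2} I₂^{m/2} Re (c exp (i (p φ₁ + q φ₂)))`, as a function of its complex
amplitude `c`. -/
noncomputable def wave (a m : ℕ) (p q : ℤ) : ℂ →ₗ[ℝ] ActionAngleFun where
  toFun c := fun I₁ I₂ φ₁ φ₂ =>
    √I₁ ^ a * √I₂ ^ m * (c * Complex.exp (Complex.I * ↑(p * φ₁ + q * φ₂))).re
  map_add' c d := by
    funext I₁ I₂ φ₁ φ₂
    simp only [Pi.add_apply, add_mul, Complex.add_re, mul_add]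
  map_smul' r c := by
    funext I₁ I₂ φ₁ φ₂
    simp only [Pi.smul_apply, smul_mul_assoc, Complex.smul_re, smul_eq_mul, RingHom.id_apply]
    ring

/-- The homogeneous D'Alembert component of degree `k` with complex Fourier coefficients `c`: the
coefficients of the cosines are `Re c` and those of the sines are `-Im c`. -/
noncomputable def fourierComp (k : ℕ) : FourierCoeff →ₗ[ℝ] ActionAngleFun :=
  ∑ m ∈ Finset.range (k + 1), ∑ p ∈ dAlembertP (k - m), ∑ q ∈ dAlembertQ m,
    wave (k - m) m p q ∘ₗ LinearMap.proj q ∘ₗ LinearMap.proj p ∘ₗ LinearMap.proj m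

/-- The functions which are given by homogeneous D'Alembert components of degree `k`, for negative
actions as well. -/
noncomputable def dAlembertSpace (k : ℕ) : Submodule ℝ ActionAngleFun :=
  LinearMap.range (fourierComp k)

theorem wave_apply (a m : ℕ) (p q : ℤ) (c : ℂ) (I₁ I₂ φ₁ φ₂ : ℝ) :
    wave a m p q c I₁ I₂ φ₁ φ₂
      = √I₁ ^ a * √I₂ ^ m * (c * Complex.exp (Complex.I * ↑(p * φ₁ + q * φ₂))).re := rfl

theorem wave_eq_cos_sin (a m : ℕ) (p q : ℤ) (c : ℂ) (I₁ I₂ φ₁ φ₂ : ℝ) :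
    wave a m p q c I₁ I₂ φ₁ φ₂ = √I₁ ^ a * √I₂ ^ m *
      (c.re * Real.cos (p * φ₁ + q * φ₂) - c.im * Real.sin (p * φ₁ + q * φ₂)) := by
  rw [wave_apply, Complex.mul_re, mul_comm Complex.I, Complex.exp_ofReal_mul_I_re,
    Complex.exp_ofReal_mul_I_im]

theorem wave_conj (a m : ℕ) (p q : ℤ) (c : ℂ) :
    wave a m (-p) (-q) (starRingEnd ℂ c) = wave a m p q c := by
  funext I₁ I₂ φ₁ φ₂
  have hneg : ((-p : ℤ) * φ₁ + (-q : ℤ) * φ₂ : ℝ) = -(p * φ₁ + q * φ₂) := by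
    push_cast
    ring
  rw [wave_eq_cos_sin, wave_eq_cos_sin, hneg, Real.cos_neg, Real.sin_neg, Complex.conj_re,
    Complex.conj_im, neg_mul_neg]

theorem re_mul_exp_mul_re_mul_exp (c d : ℂ) (α β : ℝ) :
    (c * Complex.exp (Complex.I * α)).re * (d * Complex.exp (Complex.I * β)).re
      = (c * d / 2 * Complex.exp (Complex.I * ↑(α + β))).re
        + (c * starRingEnd ℂ d / 2 * Complex.exp (Complex.I * ↑(α - β))).re := by
  have hre (z w : ℂ) : z.re * w.re = (z * w / 2).re + (z * starRingEnd ℂ w / 2).re := by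
    simp only [Complex.div_ofNat_re, Complex.mul_re, Complex.conj_re, Complex.conj_im]
    ring
  have hadd : c * d / 2 * Complex.exp (Complex.I * ↑(α + β))
      = c * Complex.exp (Complex.I * α) * (d * Complex.exp (Complex.I * β)) / 2 := by
    rw [Complex.ofReal_add, mul_add, Complex.exp_add]
    ring
  have hsub : c * starRingEnd ℂ d / 2 * Complex.exp (Complex.I * ↑(α - β))
      = c * Complex.exp (Complex.I * α)
        * starRingEnd ℂ (d * Complex.exp (Complex.I * β)) / 2 := by
    rw [map_mul, ← Complex.exp_conj, map_mul, Complex.conj_I, Complex.conj_ofReal,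
      Complex.ofReal_sub, mul_sub, sub_eq_add_neg, Complex.exp_add, neg_mul]
    ring
  rw [hadd, hsub, hre]

theorem wave_mul_wave (a m b l : ℕ) (p q r s : ℤ) (c d : ℂ) :
    wave a m p q c * wave b l r s d = wave (a + b) (m + l) (p + r) (q + s) (c * d / 2)
      + wave (a + b) (m + l) (p - r) (q - s) (c * starRingEnd ℂ d / 2) := by
  funext I₁ I₂ φ₁ φ₂
  have hadd : ((p + r : ℤ) * φ₁ + (q + s : ℤ) * φ₂ : ℝ)
      = (p * φ₁ + q * φ₂) + (r * φ₁ + s * φ₂) := by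
    push_cast
    ring
  have hsub : ((p - r : ℤ) * φ₁ + (q - s : ℤ) * φ₂ : ℝ)
      = (p * φ₁ + q * φ₂) - (r * φ₁ + s * φ₂) := by
    push_cast
    ring
  simp only [Pi.mul_apply, Pi.add_apply, wave_apply, hadd, hsub]
  rw [mul_mul_mul_comm, re_mul_exp_mul_re_mul_exp]
  ring

theorem fourierComp_apply (k : ℕ) (c : FourierCoeff) :
    fourierComp k c = ∑ m ∈ Finset.range (k + 1), ∑ p ∈ dAlembertP (k - m), ∑ q ∈ dAlembertQ m,
      wave (k - m) m p q (c m p q) := by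
  simp [fourierComp, LinearMap.sum_apply]

theorem fourierComp_congr {k : ℕ} {c d : FourierCoeff}
    (h : ∀ m ∈ Finset.range (k + 1), ∀ p ∈ dAlembertP (k - m), ∀ q ∈ dAlembertQ m,
      c m p q = d m p q) : fourierComp k c = fourierComp k d := by
  simp only [fourierComp_apply]
  exact Finset.sum_congr rfl fun m hm => Finset.sum_congr rfl fun p hp =>
    Finset.sum_congr rfl fun q hq => by rw [h m hm p hp q hq]

instance finiteDimensional_range_fourierComp (k : ℕ) :
    FiniteDimensional ℝ (LinearMap.range (fourierComp k)) :=
  finiteDimensional_range_sum _ fun _ _ => finiteDimensional_range_sum _ fun _ _ =>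
    finiteDimensional_range_sum _ fun _ _ =>
      Submodule.finiteDimensional_of_le (LinearMap.range_comp_le_range _ _)

theorem fourierComp_eq_dAlembertComp (k : ℕ) (c : FourierCoeff) :
    fourierComp k c
      = dAlembertComp k (fun m p q => (c m p q).re) (fun m p q => -(c m p q).im) := by
  funext I₁ I₂ φ₁ φ₂
  simp only [fourierComp_apply, dAlembertComp, Finset.sum_apply, wave_eq_cos_sin, Finset.mul_sum,
    Int.cast_natCast, neg_mul, sub_eq_add_neg]

theorem dAlembertComp_mem_dAlembertSpace (k : ℕ) (C S : ℕ → ℕ → ℤ → ℝ) :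
    dAlembertComp k C S ∈ dAlembertSpace k :=
  ⟨fun m p q => ⟨C m p q, -S m p q⟩, by simp only [fourierComp_eq_dAlembertComp, neg_neg]⟩

theorem isDAlembertComp_iff {k : ℕ} {f : ActionAngleFun} :
    IsDAlembertComp k f ↔ ∃ g ∈ dAlembertSpace k, f.Agree g := by
  constructor
  · rintro ⟨C, S, h⟩
    exact ⟨_, dAlembertComp_mem_dAlembertSpace k C S, h⟩
  · rintro ⟨_, ⟨c, rfl⟩, h⟩
    exact ⟨_, _, fourierComp_eq_dAlembertComp k c ▸ h⟩

theorem isDAlembertComp_of_mem {k : ℕ} {f : ActionAngleFun} (hf : f ∈ dAlembertSpace k) :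
    IsDAlembertComp k f :=
  isDAlembertComp_iff.mpr ⟨f, hf, .of_eq rfl⟩

theorem eq_of_agree {k : ℕ} {f g : ActionAngleFun} (hf : f ∈ dAlembertSpace k)
    (hg : g ∈ dAlembertSpace k) (h : f.Agree g) : f = g := by
  have hmax {f : ActionAngleFun} (hf : f ∈ dAlembertSpace k) (I₁ I₂ φ₁ φ₂ : ℝ) :
      f I₁ I₂ φ₁ φ₂ = f (max I₁ 0) (max I₂ 0) φ₁ φ₂ := by
    obtain ⟨c, rfl⟩ := hf
    have hsqrt (I : ℝ) : √(max I 0) = √I := by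
      rcases le_total I 0 with hI | hI
      · rw [max_eq_right hI, Real.sqrt_zero, Real.sqrt_eq_zero_of_nonpos hI]
      · rw [max_eq_left hI]
    simp only [fourierComp_eq_dAlembertComp, dAlembertComp, hsqrt]
  funext I₁ I₂ φ₁ φ₂
  rw [hmax hf, hmax hg]
  exact h _ _ _ _ (le_max_right _ _) (le_max_right _ _)

theorem mem_dAlembertP {k p : ℕ} : p ∈ dAlembertP k ↔ (p : ℤ) ∈ dAlembertQ k := by
  simp only [dAlembertP, dAlembertQ, Finset.mem_filter, Finset.mem_range, Finset.mem_Icc]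
  omega

theorem add_mem_dAlembertQ {k l : ℕ} {p q : ℤ} (hp : p ∈ dAlembertQ k) (hq : q ∈ dAlembertQ l) :
    p + q ∈ dAlembertQ (k + l) := by
  simp only [dAlembertQ, Finset.mem_filter, Finset.mem_Icc] at *
  omega

theorem neg_mem_dAlembertQ {k : ℕ} {p : ℤ} (hp : p ∈ dAlembertQ k) : -p ∈ dAlembertQ k := by
  simp only [dAlembertQ, Finset.mem_filter, Finset.mem_Icc] at *
  omega

theorem sub_mem_dAlembertQ {k l : ℕ} {p q : ℤ} (hp : p ∈ dAlembertQ k) (hq : q ∈ dAlembertQ l) :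
    p - q ∈ dAlembertQ (k + l) :=
  sub_eq_add_neg p q ▸ add_mem_dAlembertQ hp (neg_mem_dAlembertQ hq)

theorem wave_natCast_mem_dAlembertSpace {a m p : ℕ} {q : ℤ} (hp : p ∈ dAlembertP a)
    (hq : q ∈ dAlembertQ m) (c : ℂ) : wave a m p q c ∈ dAlembertSpace (a + m) := by
  refine ⟨Pi.single m (Pi.single p (Pi.single q c)), ?_⟩
  have hm : m ∈ Finset.range (a + m + 1) := Finset.mem_range.mpr (by omega)
  rw [fourierComp_apply, Finset.sum_eq_single_of_mem m hm, Nat.add_sub_cancel,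
    Finset.sum_eq_single_of_mem p hp, Finset.sum_eq_single_of_mem q hq]
  · simp
  · intro q' _ hq'
    simp [hq']
  · intro p' _ hp'
    simp [hp']
  · intro m' _ hm'
    simp [hm']

theorem wave_mem_dAlembertSpace {a m : ℕ} {p q : ℤ} (hp : p ∈ dAlembertQ a)
    (hq : q ∈ dAlembertQ m) (c : ℂ) : wave a m p q c ∈ dAlembertSpace (a + m) := by
  obtain ⟨r, rfl | rfl⟩ := p.eq_nat_or_neg
  · exact wave_natCast_mem_dAlembertSpace (mem_dAlembertP.mpr hp) hq c
  · rw [← wave_conj, neg_neg]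
    exact wave_natCast_mem_dAlembertSpace
      (mem_dAlembertP.mpr (by simpa using neg_mem_dAlembertQ hp)) (neg_mem_dAlembertQ hq) _

theorem mul_mem_dAlembertSpace {k l : ℕ} {f g : ActionAngleFun} (hf : f ∈ dAlembertSpace k)
    (hg : g ∈ dAlembertSpace l) : f * g ∈ dAlembertSpace (k + l) := by
  obtain ⟨c, rfl⟩ := hf
  obtain ⟨d, rfl⟩ := hg
  have hwave {a b : ℕ} (ha : a ∈ Finset.range (k + 1)) (hb : b ∈ Finset.range (l + 1)) {p q : ℤ}
      (hp : p ∈ dAlembertQ (k - a + (l - b))) (hq : q ∈ dAlembertQ (a + b)) (z : ℂ) :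
      wave (k - a + (l - b)) (a + b) p q z ∈ dAlembertSpace (k + l) := by
    rw [Finset.mem_range] at ha hb
    rw [show k + l = k - a + (l - b) + (a + b) by omega]
    exact wave_mem_dAlembertSpace hp hq z
  simp only [fourierComp_apply, Finset.sum_mul, Finset.mul_sum, wave_mul_wave]
  refine sum_mem fun b hb => sum_mem fun r hr => sum_mem fun s hs =>
    sum_mem fun a ha => sum_mem fun p hp => sum_mem fun q hq => ?_
  rw [mem_dAlembertP] at hp hr
  exact add_mem (hwave ha hb (add_mem_dAlembertQ hp hr) (add_mem_dAlembertQ hq hs) _)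
    (hwave ha hb (sub_mem_dAlembertQ hp hr) (sub_mem_dAlembertQ hq hs) _)

theorem agree_cubic_iff {f : ActionAngleFun} (hf : f = 0) (A₃₀ A₂₁ A₁₂ A₀₃ : ℝ → ℝ → ℝ) :
    f.Agree (fun I₁ I₂ φ₁ φ₂ => A₃₀ φ₁ φ₂ * √I₁ ^ 3 + A₂₁ φ₁ φ₂ * (I₁ * √I₂)
        + A₁₂ φ₁ φ₂ * (√I₁ * I₂) + A₀₃ φ₁ φ₂ * √I₂ ^ 3) ↔
      A₃₀ = 0 ∧ A₂₁ = 0 ∧ A₁₂ = 0 ∧ A₀₃ = 0 := by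
  subst hf
  constructor
  · intro h
    have hsqrt : √(4 : ℝ) = 2 := by
      rw [show (4 : ℝ) = 2 ^ 2 by norm_num, Real.sqrt_sq zero_le_two]
    have hcoeff (φ₁ φ₂ : ℝ) :
        A₃₀ φ₁ φ₂ = 0 ∧ A₂₁ φ₁ φ₂ = 0 ∧ A₁₂ φ₁ φ₂ = 0 ∧ A₀₃ φ₁ φ₂ = 0 := by
      have h₁₀ := h 1 0 φ₁ φ₂ zero_le_one le_rfl
      have h₀₁ := h 0 1 φ₁ φ₂ le_rfl zero_le_one
      have h₁₁ := h 1 1 φ₁ φ₂ zero_le_one zero_le_one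
      have h₁₄ := h 1 4 φ₁ φ₂ zero_le_one zero_le_four
      simp only [Pi.zero_apply, Real.sqrt_zero, Real.sqrt_one, hsqrt] at h₁₀ h₀₁ h₁₁ h₁₄
      refine ⟨?_, ?_, ?_, ?_⟩ <;> linarith
    exact ⟨funext₂ fun φ₁ φ₂ => (hcoeff φ₁ φ₂).1, funext₂ fun φ₁ φ₂ => (hcoeff φ₁ φ₂).2.1,
      funext₂ fun φ₁ φ₂ => (hcoeff φ₁ φ₂).2.2.1, funext₂ fun φ₁ φ₂ => (hcoeff φ₁ φ₂).2.2.2⟩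
  · rintro ⟨rfl, rfl, rfl, rfl⟩
    intro I₁ I₂ φ₁ φ₂ _ _
    simp only [Pi.zero_apply, zero_mul, add_zero]

end DAlembert

section BinaryCubicComp

variable {k : ℕ} {f g : ActionAngleFun}

theorem binaryCubicX_comp_mem_dAlembertSpace (c : Fin 4 → ℝ) (hf : f ∈ dAlembertSpace k)
    (hg : g ∈ dAlembertSpace k) :
    (fun I₁ I₂ φ₁ φ₂ => binaryCubicX c (f I₁ I₂ φ₁ φ₂) (g I₁ I₂ φ₁ φ₂))
      ∈ dAlembertSpace (k + k) := by
  convert add_mem (add_mem (Submodule.smul_mem _ (3 * c 0) (mul_mem_dAlembertSpace hf hf))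
    (Submodule.smul_mem _ (6 * c 1) (mul_mem_dAlembertSpace hf hg)))
    (Submodule.smul_mem _ (3 * c 2) (mul_mem_dAlembertSpace hg hg)) using 1
  funext I₁ I₂ φ₁ φ₂
  simp only [binaryCubicX, Pi.add_apply, Pi.smul_apply, Pi.mul_apply, smul_eq_mul]
  ring

theorem binaryCubicY_comp_mem_dAlembertSpace (c : Fin 4 → ℝ) (hf : f ∈ dAlembertSpace k)
    (hg : g ∈ dAlembertSpace k) :
    (fun I₁ I₂ φ₁ φ₂ => binaryCubicY c (f I₁ I₂ φ₁ φ₂) (g I₁ I₂ φ₁ φ₂))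
      ∈ dAlembertSpace (k + k) := by
  convert add_mem (add_mem (Submodule.smul_mem _ (3 * c 1) (mul_mem_dAlembertSpace hf hf))
    (Submodule.smul_mem _ (6 * c 2) (mul_mem_dAlembertSpace hf hg)))
    (Submodule.smul_mem _ (3 * c 3) (mul_mem_dAlembertSpace hg hg)) using 1
  funext I₁ I₂ φ₁ φ₂
  simp only [binaryCubicY, Pi.add_apply, Pi.smul_apply, Pi.mul_apply, smul_eq_mul]
  ring

theorem binaryCubic_comp_mem_dAlembertSpace (c : Fin 4 → ℝ) (hf : f ∈ dAlembertSpace k)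
    (hg : g ∈ dAlembertSpace k) :
    (fun I₁ I₂ φ₁ φ₂ => binaryCubic c (f I₁ I₂ φ₁ φ₂) (g I₁ I₂ φ₁ φ₂))
      ∈ dAlembertSpace (k + k + k) := by
  convert add_mem
    (mul_mem_dAlembertSpace (binaryCubicX_comp_mem_dAlembertSpace ((1 / 3 : ℝ) • c) hf hg) hf)
    (mul_mem_dAlembertSpace (binaryCubicY_comp_mem_dAlembertSpace ((1 / 3 : ℝ) • c) hf hg) hg)
    using 1
  funext I₁ I₂ φ₁ φ₂
  simp only [binaryCubic, binaryCubicX, binaryCubicY, Pi.add_apply, Pi.smul_apply, Pi.mul_apply,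
    smul_eq_mul]
  ring

end BinaryCubicComp

namespace PRModel

variable {M : PRModel}

/-- `f` is differentiable in each of the two angles and `g = D f`. -/
def HasD (M : PRModel) (f g : ActionAngleFun) : Prop :=
  ∀ I₁ I₂ φ₁ φ₂ : ℝ, ∃ d₁ d₂ : ℝ, HasDerivAt (fun t => f I₁ I₂ t φ₂) d₁ φ₁ ∧
    HasDerivAt (fun t => f I₁ I₂ φ₁ t) d₂ φ₂ ∧ g I₁ I₂ φ₁ φ₂ = M.ω₁ * d₁ - M.ω₂ * d₂

/-- The frequency `ω₁ p - ω₂ q` of the waves of index `(p, q)` under the flow of `D`. -/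
noncomputable def freq (M : PRModel) (p q : ℤ) : ℝ := M.ω₁ * p - M.ω₂ * q

/-- The symbol of `D`: it acts on Fourier coefficients as multiplication by `i (ω₁ p - ω₂ q)`. -/
noncomputable def symbolD (M : PRModel) : FourierCoeff := fun _ p q => Complex.I * M.freq p q

namespace HasD

variable {f g f' g' : ActionAngleFun}

theorem D_eq (h : M.HasD f f') : M.D f = f' := by
  funext I₁ I₂ φ₁ φ₂
  obtain ⟨d₁, d₂, h₁, h₂, hd⟩ := h I₁ I₂ φ₁ φ₂
  rw [D, h₁.deriv, h₂.deriv, hd]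

theorem add (hf : M.HasD f f') (hg : M.HasD g g') : M.HasD (f + g) (f' + g') := by
  intro I₁ I₂ φ₁ φ₂
  obtain ⟨d₁, d₂, h₁, h₂, hd⟩ := hf I₁ I₂ φ₁ φ₂
  obtain ⟨e₁, e₂, h₁', h₂', he⟩ := hg I₁ I₂ φ₁ φ₂
  refine ⟨_, _, h₁.fun_add h₁', h₂.fun_add h₂', ?_⟩
  simp only [Pi.add_apply, hd, he]
  ring

theorem mul (hf : M.HasD f f') (hg : M.HasD g g') : M.HasD (f * g) (f' * g + f * g') := by
  intro I₁ I₂ φ₁ φ₂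
  obtain ⟨d₁, d₂, h₁, h₂, hd⟩ := hf I₁ I₂ φ₁ φ₂
  obtain ⟨e₁, e₂, h₁', h₂', he⟩ := hg I₁ I₂ φ₁ φ₂
  refine ⟨_, _, h₁.fun_mul h₁', h₂.fun_mul h₂', ?_⟩
  simp only [Pi.add_apply, Pi.mul_apply, hd, he]
  ring

theorem const_smul (r : ℝ) (hf : M.HasD f f') : M.HasD (r • f) (r • f') := by
  intro I₁ I₂ φ₁ φ₂
  obtain ⟨d₁, d₂, h₁, h₂, hd⟩ := hf I₁ I₂ φ₁ φ₂
  refine ⟨_, _, h₁.const_mul r, h₂.const_mul r, ?_⟩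
  simp only [Pi.smul_apply, smul_eq_mul, hd]
  ring

theorem sum {ι : Type*} (s : Finset ι) {f f' : ι → ActionAngleFun}
    (h : ∀ i ∈ s, M.HasD (f i) (f' i)) : M.HasD (∑ i ∈ s, f i) (∑ i ∈ s, f' i) := by
  induction s using Finset.cons_induction with
  | empty => exact fun _ _ _ _ => ⟨0, 0, hasDerivAt_const _ _, hasDerivAt_const _ _, by simp⟩
  | cons i s hi ih =>
    rw [Finset.sum_cons, Finset.sum_cons]
    exact (h i (Finset.mem_cons_self i s)).add (ih fun j hj => h j (Finset.mem_cons_of_mem hj))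

theorem binaryCubic (c : Fin 4 → ℝ) (hf : M.HasD f f') (hg : M.HasD g g') :
    M.HasD (fun I₁ I₂ φ₁ φ₂ => binaryCubic c (f I₁ I₂ φ₁ φ₂) (g I₁ I₂ φ₁ φ₂))
      (fun I₁ I₂ φ₁ φ₂ => binaryCubicX c (f I₁ I₂ φ₁ φ₂) (g I₁ I₂ φ₁ φ₂) * f' I₁ I₂ φ₁ φ₂
        + binaryCubicY c (f I₁ I₂ φ₁ φ₂) (g I₁ I₂ φ₁ φ₂) * g' I₁ I₂ φ₁ φ₂) := by
  intro I₁ I₂ φ₁ φ₂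
  obtain ⟨d₁, d₂, h₁, h₂, hd⟩ := hf I₁ I₂ φ₁ φ₂
  obtain ⟨e₁, e₂, h₁', h₂', he⟩ := hg I₁ I₂ φ₁ φ₂
  refine ⟨_, _, hasDerivAt_binaryCubic c h₁ h₁', hasDerivAt_binaryCubic c h₂ h₂', ?_⟩
  simp only [hd, he]
  ring

theorem binaryCubicX (c : Fin 4 → ℝ) (hf : M.HasD f f') (hg : M.HasD g g') :
    M.HasD (fun I₁ I₂ φ₁ φ₂ => binaryCubicX c (f I₁ I₂ φ₁ φ₂) (g I₁ I₂ φ₁ φ₂))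
      (fun I₁ I₂ φ₁ φ₂ =>
        6 * ((c 0 * f I₁ I₂ φ₁ φ₂ + c 1 * g I₁ I₂ φ₁ φ₂) * f' I₁ I₂ φ₁ φ₂
          + (c 1 * f I₁ I₂ φ₁ φ₂ + c 2 * g I₁ I₂ φ₁ φ₂) * g' I₁ I₂ φ₁ φ₂)) := by
  intro I₁ I₂ φ₁ φ₂
  obtain ⟨d₁, d₂, h₁, h₂, hd⟩ := hf I₁ I₂ φ₁ φ₂
  obtain ⟨e₁, e₂, h₁', h₂', he⟩ := hg I₁ I₂ φ₁ φ₂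
  refine ⟨_, _, hasDerivAt_binaryCubicX c h₁ h₁', hasDerivAt_binaryCubicX c h₂ h₂', ?_⟩
  simp only [hd, he]
  ring

theorem binaryCubicY (c : Fin 4 → ℝ) (hf : M.HasD f f') (hg : M.HasD g g') :
    M.HasD (fun I₁ I₂ φ₁ φ₂ => binaryCubicY c (f I₁ I₂ φ₁ φ₂) (g I₁ I₂ φ₁ φ₂))
      (fun I₁ I₂ φ₁ φ₂ =>
        6 * ((c 1 * f I₁ I₂ φ₁ φ₂ + c 2 * g I₁ I₂ φ₁ φ₂) * f' I₁ I₂ φ₁ φ₂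
          + (c 2 * f I₁ I₂ φ₁ φ₂ + c 3 * g I₁ I₂ φ₁ φ₂) * g' I₁ I₂ φ₁ φ₂)) := by
  intro I₁ I₂ φ₁ φ₂
  obtain ⟨d₁, d₂, h₁, h₂, hd⟩ := hf I₁ I₂ φ₁ φ₂
  obtain ⟨e₁, e₂, h₁', h₂', he⟩ := hg I₁ I₂ φ₁ φ₂
  refine ⟨_, _, hasDerivAt_binaryCubicY c h₁ h₁', hasDerivAt_binaryCubicY c h₂ h₂', ?_⟩
  simp only [hd, he]
  ring

theorem neg (hf : M.HasD f f') : M.HasD (-f) (-f') := by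
  simpa using hf.const_smul (-1)

end HasD

theorem hasD_wave (M : PRModel) (a m : ℕ) (p q : ℤ) (c : ℂ) :
    M.HasD (wave a m p q c) (wave a m p q (Complex.I * M.freq p q * c)) := by
  intro I₁ I₂ φ₁ φ₂
  have harg₁ : HasDerivAt (fun t : ℝ => p * t + q * φ₂) (p : ℝ) φ₁ := by
    simpa using ((hasDerivAt_id' φ₁).const_mul (p : ℝ)).add_const (q * φ₂)
  have harg₂ : HasDerivAt (fun t : ℝ => p * φ₁ + q * t) (q : ℝ) φ₂ := by
    simpa using ((hasDerivAt_id' φ₂).const_mul (q : ℝ)).const_add (p * φ₁)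
  simp only [wave_eq_cos_sin]
  refine ⟨_, _, ((harg₁.cos.const_mul c.re).fun_sub (harg₁.sin.const_mul c.im)).const_mul _,
    ((harg₂.cos.const_mul c.re).fun_sub (harg₂.sin.const_mul c.im)).const_mul _, ?_⟩
  simp only [freq, Complex.mul_re, Complex.mul_im, Complex.I_re, Complex.I_im, Complex.ofReal_re,
    Complex.ofReal_im]
  ring

theorem hasD_fourierComp (M : PRModel) (k : ℕ) (c : FourierCoeff) :
    M.HasD (fourierComp k c) (fourierComp k (M.symbolD * c)) := by
  simp only [fourierComp_apply]
  exact .sum _ fun m _ => .sum _ fun p _ => .sum _ fun q _ => M.hasD_wave _ _ _ _ _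

theorem D_fourierComp (M : PRModel) (k : ℕ) (c : FourierCoeff) :
    M.D (fourierComp k c) = fourierComp k (M.symbolD * c) :=
  (M.hasD_fourierComp k c).D_eq

theorem hasD_D_of_mem {k : ℕ} {f : ActionAngleFun} (hf : f ∈ dAlembertSpace k) :
    M.HasD f (M.D f) := by
  obtain ⟨c, rfl⟩ := hf
  rw [D_fourierComp]
  exact M.hasD_fourierComp k c

theorem D_mem_dAlembertSpace {k : ℕ} {f : ActionAngleFun} (hf : f ∈ dAlembertSpace k) :
    M.D f ∈ dAlembertSpace k := by
  obtain ⟨c, rfl⟩ := hf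
  exact ⟨_, (M.D_fourierComp k c).symm⟩

theorem eq_zero_of_D_eq_zero {k : ℕ} {f : ActionAngleFun} (hf : f ∈ dAlembertSpace k)
    (hfreq : ∀ m ∈ Finset.range (k + 1), ∀ p ∈ dAlembertP (k - m), ∀ q ∈ dAlembertQ m,
      M.freq p q ≠ 0) (hD : M.D f = 0) : f = 0 := by
  obtain ⟨c, rfl⟩ := hf
  refine map_eq_zero_of_map_apply_eq_zero (A := LinearMap.mulLeft ℝ M.symbolD) ?_ ?_
    ((M.D_fourierComp k c).symm.trans hD)
  · intro d hd
    rw [LinearMap.mulLeft_apply, ← D_fourierComp, hd]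
    funext I₁ I₂ φ₁ φ₂
    simp [D]
  · intro d
    refine ⟨fun m p q => d m p q / M.symbolD m p q, fourierComp_congr fun m hm p hp q hq => ?_⟩
    exact mul_div_cancel₀ _ (mul_ne_zero Complex.I_ne_zero
      (Complex.ofReal_ne_zero.mpr (hfreq m hm p hp q hq)))

section LinearNormalForm

theorem charEq_I_mul_eq_zero_iff (w : ℝ) :
    M.charEq (Complex.I * w) = 0 ↔ w ^ 4 - 2 * (M.E + M.F + M.n ^ 2) * w ^ 2
      + ((2 * M.E - M.n ^ 2) * (2 * M.F - M.n ^ 2) - M.G ^ 2) = 0 := by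
  rw [← Complex.ofReal_eq_zero, charEq]
  push_cast
  have hI₄ : Complex.I ^ 4 = 1 := Complex.I_pow_four
  rw [mul_pow, mul_pow, Complex.I_sq, hI₄]
  ring_nf

theorem sq_add_sq_frequencies (hfreq : M.HasFrequencies) :
    M.ω₁ ^ 2 + M.ω₂ ^ 2 = 2 * (M.E + M.F + M.n ^ 2) := by
  obtain ⟨hω₂, hω, h₁, h₂⟩ := hfreq
  rw [charEq_I_mul_eq_zero_iff] at h₁ h₂
  have hne : M.ω₁ ^ 2 - M.ω₂ ^ 2 ≠ 0 := (sub_pos.mpr (pow_lt_pow_left₀ hω hω₂.le two_ne_zero)).ne'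
  exact mul_left_cancel₀ hne (by linear_combination h₁ - h₂)

theorem sq_mul_sq_frequencies (hfreq : M.HasFrequencies) :
    M.ω₁ ^ 2 * M.ω₂ ^ 2 = (2 * M.E - M.n ^ 2) * (2 * M.F - M.n ^ 2) - M.G ^ 2 := by
  linear_combination M.ω₁ ^ 2 * sq_add_sq_frequencies hfreq
    - (charEq_I_mul_eq_zero_iff M.ω₁).mp hfreq.2.2.1

theorem ω₁_pos (hfreq : M.HasFrequencies) : 0 < M.ω₁ := hfreq.1.trans hfreq.2.1

theorem two_F_lt (hfreq : M.HasFrequencies) (hEF : M.E + M.F < M.n ^ 2) :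
    2 * M.F < M.n ^ 2 := by
  by_contra! hF
  have hpos : 0 < (2 * M.E - M.n ^ 2) * (2 * M.F - M.n ^ 2) - M.G ^ 2 :=
    sq_mul_sq_frequencies hfreq ▸ mul_pos (pow_pos (ω₁_pos hfreq) 2) (pow_pos hfreq.1 2)
  have hnonpos : (2 * M.E - M.n ^ 2) * (2 * M.F - M.n ^ 2) ≤ 0 :=
    mul_nonpos_of_nonpos_of_nonneg (by linarith) (by linarith)
  linarith [sq_nonneg M.G]

theorem G_sq_eq (hfreq : M.HasFrequencies) :
    M.G ^ 2 = -((M.ω₁ ^ 2 + M.n ^ 2 - 2 * M.F) * (M.ω₂ ^ 2 + M.n ^ 2 - 2 * M.F))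
      + 4 * M.n ^ 2 * (M.n ^ 2 - 2 * M.F) := by
  linear_combination (M.n ^ 2 - 2 * M.F) * sq_add_sq_frequencies hfreq
    + sq_mul_sq_frequencies hfreq

theorem k_pos (hfreq : M.HasFrequencies) : 0 < M.k :=
  Real.sqrt_pos.mpr (sub_pos.mpr (pow_lt_pow_left₀ hfreq.2.1 hfreq.1.le two_ne_zero))

theorem k_sq (hfreq : M.HasFrequencies) : M.k ^ 2 = M.ω₁ ^ 2 - M.ω₂ ^ 2 :=
  Real.sq_sqrt (sub_pos.mpr (pow_lt_pow_left₀ hfreq.2.1 hfreq.1.le two_ne_zero)).le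

/-- The normalization factor `2 / (ω l k)`, with `l² = 4 (ω² + n² - 2F)`, common to the entries of
the two columns of `J` that belong to the mode of frequency `ω`. -/
noncomputable def amplitude (M : PRModel) (ω : ℝ) : ℝ :=
  2 / (ω * √(4 * (ω ^ 2 + M.n ^ 2 - 2 * M.F)) * M.k)

theorem sqrt_pos_of_two_F_lt (hF : 2 * M.F < M.n ^ 2) (ω : ℝ) :
    0 < √(4 * (ω ^ 2 + M.n ^ 2 - 2 * M.F)) :=
  Real.sqrt_pos.mpr (by linarith [sq_nonneg ω])

theorem sq_sqrt_of_two_F_lt (hF : 2 * M.F < M.n ^ 2) (ω : ℝ) :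
    √(4 * (ω ^ 2 + M.n ^ 2 - 2 * M.F)) ^ 2 = 4 * (ω ^ 2 + M.n ^ 2 - 2 * M.F) :=
  Real.sq_sqrt (by linarith [sq_nonneg ω])

theorem amplitude_sq (hfreq : M.HasFrequencies) (hF : 2 * M.F < M.n ^ 2) {ω : ℝ} (hω : ω ≠ 0) :
    M.amplitude ω ^ 2 * ω ^ 2 * (ω ^ 2 + M.n ^ 2 - 2 * M.F) * (M.ω₁ ^ 2 - M.ω₂ ^ 2) = 1 := by
  have hl := sqrt_pos_of_two_F_lt hF ω
  have hk := k_pos hfreq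
  rw [← k_sq hfreq, ← mul_div_cancel_left₀ (ω ^ 2 + M.n ^ 2 - 2 * M.F) (four_ne_zero (α := ℝ)),
    ← sq_sqrt_of_two_F_lt hF, amplitude]
  field_simp
  norm_num

theorem sqrt_div_eq_amplitude_mul (hF : 2 * M.F < M.n ^ 2) (ω : ℝ) :
    √(4 * (ω ^ 2 + M.n ^ 2 - 2 * M.F)) / (2 * ω * M.k)
      = M.amplitude ω * (ω ^ 2 + M.n ^ 2 - 2 * M.F) := by
  have hl := sqrt_pos_of_two_F_lt hF ω
  rw [amplitude, ← mul_div_cancel_left₀ (ω ^ 2 + M.n ^ 2 - 2 * M.F) (four_ne_zero (α := ℝ)),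
    ← sq_sqrt_of_two_F_lt hF]
  field_simp
  norm_num

theorem div_sqrt_eq_amplitude_mul {ω : ℝ} (hω : ω ≠ 0) :
    4 * M.n * ω / (√(4 * (ω ^ 2 + M.n ^ 2 - 2 * M.F)) * M.k)
      = 2 * M.n * ω ^ 2 * M.amplitude ω := by
  rw [amplitude]
  field_simp
  ring

theorem J₁₃_eq (hF : 2 * M.F < M.n ^ 2) :
    M.J₁₃ = M.amplitude M.ω₁ * (M.ω₁ ^ 2 + M.n ^ 2 - 2 * M.F) :=
  sqrt_div_eq_amplitude_mul hF M.ω₁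

theorem J₁₄_eq (hF : 2 * M.F < M.n ^ 2) :
    M.J₁₄ = M.amplitude M.ω₂ * (M.ω₂ ^ 2 + M.n ^ 2 - 2 * M.F) :=
  sqrt_div_eq_amplitude_mul hF M.ω₂

theorem J₂₁_eq (hω₁ : M.ω₁ ≠ 0) : M.J₂₁ = -(2 * M.n * M.ω₁ ^ 2 * M.amplitude M.ω₁) := by
  rw [← div_sqrt_eq_amplitude_mul hω₁, ← neg_div, J₂₁, l₁]

theorem J₂₂_eq (hω₂ : M.ω₂ ≠ 0) : M.J₂₂ = 2 * M.n * M.ω₂ ^ 2 * M.amplitude M.ω₂ :=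
  div_sqrt_eq_amplitude_mul hω₂

theorem J₂₃_eq (M : PRModel) : M.J₂₃ = M.G * M.amplitude M.ω₁ := by
  rw [J₂₃, amplitude, l₁]
  ring

theorem J₂₄_eq (M : PRModel) : M.J₂₄ = M.G * M.amplitude M.ω₂ := by
  rw [J₂₄, amplitude, l₂]
  ring

theorem J_mem_symplecticGroup (hfreq : M.HasFrequencies) (hF : 2 * M.F < M.n ^ 2) :
    M.J ∈ Matrix.symplecticGroup (Fin 2) ℝ := by
  have hω₁ := (ω₁_pos hfreq).ne'
  have hω₂ := hfreq.1.ne'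
  have hG := G_sq_eq hfreq
  have hamp₁ := amplitude_sq hfreq hF hω₁
  have hamp₂ := amplitude_sq hfreq hF hω₂
  rw [J, SymplecticGroup.fromBlocks_mem_iff, J₁₃_eq hF, J₁₄_eq hF, J₂₁_eq hω₁, J₂₂_eq hω₂, J₂₃_eq,
    J₂₄_eq]
  generalize M.amplitude M.ω₁ = t₁, M.amplitude M.ω₂ = t₂ at *
  simp only [← Matrix.ext_iff, Fin.forall_fin_two, Matrix.sub_apply, Matrix.mul_apply,
    Matrix.transpose_apply, Fin.sum_univ_two, Matrix.of_apply, Matrix.cons_val',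
    Matrix.cons_val_zero, Matrix.cons_val_one, Matrix.cons_val_fin_one, Matrix.one_fin_two]
  refine ⟨⟨⟨?_, ?_⟩, ?_, ?_⟩, ⟨⟨?_, ?_⟩, ?_, ?_⟩, ⟨?_, ?_⟩, ?_, ?_⟩
  iterate 8 ring
  · linear_combination hamp₁ + t₁ ^ 2 * M.ω₁ ^ 2 * hG
  · linear_combination t₁ * t₂ * M.ω₁ ^ 2 * hG
  · linear_combination -(t₁ * t₂ * M.ω₂ ^ 2) * hG
  · linear_combination hamp₂ - t₂ ^ 2 * M.ω₂ ^ 2 * hG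

section MulVec

variable (M) (X : Fin 2 ⊕ Fin 2 → ℝ)

theorem J_mulVec_inl_zero :
    M.J.mulVec X (.inl 0) = M.J₁₃ * X (.inr 0) + M.J₁₄ * X (.inr 1) := by
  simp [J, Matrix.mulVec, dotProduct]

theorem J_mulVec_inl_one :
    M.J.mulVec X (.inl 1) = M.J₂₁ * X (.inl 0) + M.J₂₂ * X (.inl 1)
      + (M.J₂₃ * X (.inr 0) + M.J₂₄ * X (.inr 1)) := by
  simp [J, Matrix.mulVec, dotProduct]

theorem J_mulVec_inr_zero :
    M.J.mulVec X (.inr 0) = -M.ω₁ ^ 2 * M.J₁₃ * X (.inl 0) + M.ω₂ ^ 2 * M.J₁₄ * X (.inl 1)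
      - M.n * M.J.mulVec X (.inl 1) := by
  rw [J_mulVec_inl_one]
  simp only [J, Matrix.mulVec, dotProduct, Fintype.sum_sum_type, Fin.sum_univ_two,
    Matrix.fromBlocks_apply₂₁, Matrix.fromBlocks_apply₂₂, Matrix.of_apply, Matrix.cons_val',
    Matrix.cons_val_zero, Matrix.cons_val_one, Matrix.cons_val_fin_one]
  ring

theorem J_mulVec_inr_one :
    M.J.mulVec X (.inr 1) = -M.ω₁ ^ 2 * M.J₂₃ * X (.inl 0) + M.ω₂ ^ 2 * M.J₂₄ * X (.inl 1)
      + (M.J₂₁ * X (.inr 0) - M.J₂₂ * X (.inr 1)) + M.n * M.J.mulVec X (.inl 0) := by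
  rw [J_mulVec_inl_zero]
  simp only [J, Matrix.mulVec, dotProduct, Fintype.sum_sum_type, Fin.sum_univ_two,
    Matrix.fromBlocks_apply₂₁, Matrix.fromBlocks_apply₂₂, Matrix.of_apply, Matrix.cons_val',
    Matrix.cons_val_zero, Matrix.cons_val_one, Matrix.cons_val_fin_one]
  ring

end MulVec

theorem H₂_J_mulVec (hfreq : M.HasFrequencies) (hF : 2 * M.F < M.n ^ 2)
    (X : Fin 2 ⊕ Fin 2 → ℝ) :
    M.H₂ (M.J.mulVec X) = (X (.inr 0) ^ 2 + M.ω₁ ^ 2 * X (.inl 0) ^ 2) / 2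
      - (X (.inr 1) ^ 2 + M.ω₂ ^ 2 * X (.inl 1) ^ 2) / 2 := by
  have hω₁ := (ω₁_pos hfreq).ne'
  have hω₂ := hfreq.1.ne'
  have hG := G_sq_eq hfreq
  have hE : M.E = (M.ω₁ ^ 2 + M.ω₂ ^ 2) / 2 - M.F - M.n ^ 2 := by
    linear_combination -(sq_add_sq_frequencies hfreq) / 2
  have hamp₁ := amplitude_sq hfreq hF hω₁
  have hamp₂ := amplitude_sq hfreq hF hω₂
  rw [H₂, J_mulVec_inr_zero, J_mulVec_inr_one, J_mulVec_inl_zero, J_mulVec_inl_one, J₁₃_eq hF,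
    J₁₄_eq hF, J₂₁_eq hω₁, J₂₂_eq hω₂, J₂₃_eq, J₂₄_eq, hE]
  generalize M.amplitude M.ω₁ = t₁, M.amplitude M.ω₂ = t₂ at *
  generalize X (.inl 0) = Q₁, X (.inl 1) = Q₂, X (.inr 0) = P₁, X (.inr 1) = P₂
  linear_combination ((P₁ ^ 2 + M.ω₁ ^ 2 * Q₁ ^ 2) / 2) * hamp₁
    - ((P₂ ^ 2 + M.ω₂ ^ 2 * Q₂ ^ 2) / 2) * hamp₂
    + (t₁ ^ 2 * ((2 * M.ω₁ ^ 2 + M.n ^ 2 - 2 * M.F) * P₁ ^ 2 + M.ω₁ ^ 4 * Q₁ ^ 2) / 2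
      + t₂ ^ 2 * ((2 * M.ω₂ ^ 2 + M.n ^ 2 - 2 * M.F) * P₂ ^ 2 + M.ω₂ ^ 4 * Q₂ ^ 2) / 2
      + t₁ * t₂ * ((M.ω₁ ^ 2 + M.ω₂ ^ 2 + M.n ^ 2 - 2 * M.F) * (P₁ * P₂)
        - M.ω₁ ^ 2 * M.ω₂ ^ 2 * (Q₁ * Q₂))) * hG

end LinearNormalForm

section FirstOrder

/-- The normal coordinate of index `j` (that is `Q₁, Q₂, P₁, P₂` for `j` equal to `inl 0`, `inl 1`,
`inr 0`, `inr 1`) as a function of action-angle variables. -/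
noncomputable def normalCoord (M : PRModel) (j : Fin 2 ⊕ Fin 2) : ActionAngleFun :=
  fun I₁ I₂ φ₁ φ₂ => M.T I₁ I₂ φ₁ φ₂ j

theorem sqrt_mul_eq_mul_sqrt_div {ω : ℝ} (hω : 0 < ω) (I : ℝ) :
    √(2 * I * ω) = ω * √(2 * I / ω) := by
  rw [← Real.sqrt_sq hω.le, ← Real.sqrt_mul (sq_nonneg ω), Real.sqrt_sq hω.le]
  congr 1
  field_simp

theorem H₂_J_mulVec_T (hfreq : M.HasFrequencies) (hF : 2 * M.F < M.n ^ 2) {I₁ I₂ : ℝ}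
    (hI₁ : 0 ≤ I₁) (hI₂ : 0 ≤ I₂) (φ₁ φ₂ : ℝ) :
    M.H₂ (M.J.mulVec (M.T I₁ I₂ φ₁ φ₂)) = M.ω₁ * I₁ - M.ω₂ * I₂ := by
  have hmode {ω I : ℝ} (hω : 0 < ω) (hI : 0 ≤ I) (φ : ℝ) :
      ((√(2 * I * ω) * Real.cos φ) ^ 2 + ω ^ 2 * (√(2 * I / ω) * Real.sin φ) ^ 2) / 2
        = ω * I := by
    have hsq : ω * √(2 * I / ω) ^ 2 = 2 * I := by
      rw [Real.sq_sqrt (by positivity), mul_div_cancel₀ _ hω.ne']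
    rw [sqrt_mul_eq_mul_sqrt_div hω]
    linear_combination ω * √(2 * I / ω) ^ 2 * ω / 2 * Real.sin_sq_add_cos_sq φ + ω / 2 * hsq
  rw [H₂_J_mulVec hfreq hF, ← hmode (ω₁_pos hfreq) hI₁ φ₁, ← hmode hfreq.1 hI₂ φ₂]
  rfl

theorem normalCoord_inl_zero (hω₁ : 0 < M.ω₁) :
    M.normalCoord (.inl 0) = wave 1 0 1 0 (-(Complex.I * √(2 / M.ω₁))) := by
  funext I₁ I₂ φ₁ φ₂
  have hsqrt : √(2 * I₁ / M.ω₁) = √I₁ * √(2 / M.ω₁) := by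
    rw [← Real.sqrt_mul' _ (by positivity), mul_comm 2 I₁, mul_div_assoc]
  simp [wave_eq_cos_sin, normalCoord, T, hsqrt, mul_assoc]

theorem normalCoord_inl_one (hω₂ : 0 < M.ω₂) :
    M.normalCoord (.inl 1) = wave 0 1 0 1 (-(Complex.I * √(2 / M.ω₂))) := by
  funext I₁ I₂ φ₁ φ₂
  have hsqrt : √(2 * I₂ / M.ω₂) = √I₂ * √(2 / M.ω₂) := by
    rw [← Real.sqrt_mul' _ (by positivity), mul_comm 2 I₂, mul_div_assoc]
  simp [wave_eq_cos_sin, normalCoord, T, hsqrt, mul_assoc]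

theorem normalCoord_inr_zero (hω₁ : 0 < M.ω₁) :
    M.normalCoord (.inr 0) = wave 1 0 1 0 ↑(M.ω₁ * √(2 / M.ω₁)) := by
  funext I₁ I₂ φ₁ φ₂
  have hsqrt : √(2 * I₁ * M.ω₁) = √I₁ * (M.ω₁ * √(2 / M.ω₁)) := by
    rw [sqrt_mul_eq_mul_sqrt_div hω₁, mul_left_comm, ← Real.sqrt_mul' _ (by positivity),
      mul_comm 2 I₁, mul_div_assoc]
  rw [wave_eq_cos_sin, Complex.ofReal_re, Complex.ofReal_im]
  simp only [normalCoord, T, Sum.elim_inr, Matrix.cons_val_zero, hsqrt]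
  simp [mul_assoc]

theorem normalCoord_inr_one (hω₂ : 0 < M.ω₂) :
    M.normalCoord (.inr 1) = wave 0 1 0 1 ↑(M.ω₂ * √(2 / M.ω₂)) := by
  funext I₁ I₂ φ₁ φ₂
  have hsqrt : √(2 * I₂ * M.ω₂) = √I₂ * (M.ω₂ * √(2 / M.ω₂)) := by
    rw [sqrt_mul_eq_mul_sqrt_div hω₂, mul_left_comm, ← Real.sqrt_mul' _ (by positivity),
      mul_comm 2 I₂, mul_div_assoc]
  rw [wave_eq_cos_sin, Complex.ofReal_re, Complex.ofReal_im]
  simp only [normalCoord, T, Sum.elim_inr, Matrix.cons_val_one, Matrix.cons_val_fin_one, hsqrt]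
  simp [mul_assoc]

theorem hasD_normalCoord_inl_zero (hω₁ : 0 < M.ω₁) :
    M.HasD (M.normalCoord (.inl 0)) (M.normalCoord (.inr 0)) := by
  rw [normalCoord_inl_zero hω₁, normalCoord_inr_zero hω₁]
  convert M.hasD_wave 1 0 1 0 _ using 2
  simp only [freq]
  push_cast
  linear_combination (M.ω₁ * √(2 / M.ω₁) : ℂ) * Complex.I_sq

theorem hasD_normalCoord_inl_one (hω₂ : 0 < M.ω₂) :
    M.HasD (M.normalCoord (.inl 1)) (-M.normalCoord (.inr 1)) := by
  rw [normalCoord_inl_one hω₂, normalCoord_inr_one hω₂, ← map_neg]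
  convert M.hasD_wave 0 1 0 1 _ using 2
  simp only [freq]
  push_cast
  linear_combination -(M.ω₂ * √(2 / M.ω₂) : ℂ) * Complex.I_sq

theorem hasD_normalCoord_inr_zero (hω₁ : 0 < M.ω₁) :
    M.HasD (M.normalCoord (.inr 0)) (-M.ω₁ ^ 2 • M.normalCoord (.inl 0)) := by
  rw [normalCoord_inl_zero hω₁, normalCoord_inr_zero hω₁, ← map_smul]
  convert M.hasD_wave 1 0 1 0 _ using 2
  simp only [freq, Complex.real_smul]
  push_cast
  ring

theorem hasD_normalCoord_inr_one (hω₂ : 0 < M.ω₂) :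
    M.HasD (M.normalCoord (.inr 1)) (M.ω₂ ^ 2 • M.normalCoord (.inl 1)) := by
  rw [normalCoord_inl_one hω₂, normalCoord_inr_one hω₂, ← map_smul]
  convert M.hasD_wave 0 1 0 1 _ using 2
  simp only [freq, Complex.real_smul]
  push_cast
  ring

theorem normalCoord_mem_dAlembertSpace (hω₁ : 0 < M.ω₁) (hω₂ : 0 < M.ω₂) (j : Fin 2 ⊕ Fin 2) :
    M.normalCoord j ∈ dAlembertSpace 1 := by
  have h₁ (c : ℂ) : wave 1 0 1 0 c ∈ dAlembertSpace 1 :=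
    wave_mem_dAlembertSpace (a := 1) (m := 0) (by simp [dAlembertQ]) (by simp [dAlembertQ]) c
  have h₂ (c : ℂ) : wave 0 1 0 1 c ∈ dAlembertSpace 1 :=
    wave_mem_dAlembertSpace (a := 0) (m := 1) (by simp [dAlembertQ]) (by simp [dAlembertQ]) c
  rcases j with j | j <;> fin_cases j
  · exact normalCoord_inl_zero hω₁ ▸ h₁ _
  · exact normalCoord_inl_one hω₂ ▸ h₂ _
  · exact normalCoord_inr_zero hω₁ ▸ h₁ _
  · exact normalCoord_inr_one hω₂ ▸ h₂ _

theorem B₁x_eq (M : PRModel) :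
    M.B₁x = M.J₁₃ • M.normalCoord (.inr 0) + M.J₁₄ • M.normalCoord (.inr 1) := by
  funext I₁ I₂ φ₁ φ₂
  exact M.J_mulVec_inl_zero _

theorem B₁y_eq (M : PRModel) :
    M.B₁y = M.J₂₁ • M.normalCoord (.inl 0) + M.J₂₂ • M.normalCoord (.inl 1)
      + (M.J₂₃ • M.normalCoord (.inr 0) + M.J₂₄ • M.normalCoord (.inr 1)) := by
  funext I₁ I₂ φ₁ φ₂
  exact M.J_mulVec_inl_one _

theorem B₁x_mem_dAlembertSpace (hω₁ : 0 < M.ω₁) (hω₂ : 0 < M.ω₂) :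
    M.B₁x ∈ dAlembertSpace 1 := by
  have h := normalCoord_mem_dAlembertSpace hω₁ hω₂
  rw [B₁x_eq]
  exact add_mem (Submodule.smul_mem _ _ (h _)) (Submodule.smul_mem _ _ (h _))

theorem B₁y_mem_dAlembertSpace (hω₁ : 0 < M.ω₁) (hω₂ : 0 < M.ω₂) :
    M.B₁y ∈ dAlembertSpace 1 := by
  have h := normalCoord_mem_dAlembertSpace hω₁ hω₂
  rw [B₁y_eq]
  exact add_mem (add_mem (Submodule.smul_mem _ _ (h _)) (Submodule.smul_mem _ _ (h _)))
    (add_mem (Submodule.smul_mem _ _ (h _)) (Submodule.smul_mem _ _ (h _)))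

theorem D_B₁x (hω₁ : 0 < M.ω₁) (hω₂ : 0 < M.ω₂) :
    M.D M.B₁x = M.J₁₃ • (-M.ω₁ ^ 2 • M.normalCoord (.inl 0))
      + M.J₁₄ • (M.ω₂ ^ 2 • M.normalCoord (.inl 1)) := by
  rw [B₁x_eq]
  exact (((hasD_normalCoord_inr_zero hω₁).const_smul _).add
    ((hasD_normalCoord_inr_one hω₂).const_smul _)).D_eq

theorem D_B₁y (hω₁ : 0 < M.ω₁) (hω₂ : 0 < M.ω₂) :
    M.D M.B₁y = M.J₂₁ • M.normalCoord (.inr 0) + M.J₂₂ • -M.normalCoord (.inr 1)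
      + (M.J₂₃ • (-M.ω₁ ^ 2 • M.normalCoord (.inl 0))
        + M.J₂₄ • (M.ω₂ ^ 2 • M.normalCoord (.inl 1))) := by
  rw [B₁y_eq]
  exact ((((hasD_normalCoord_inl_zero hω₁).const_smul _).add
    ((hasD_normalCoord_inl_one hω₂).const_smul _)).add
    (((hasD_normalCoord_inr_zero hω₁).const_smul _).add
    ((hasD_normalCoord_inr_one hω₂).const_smul _))).D_eq

theorem D_D_B₁x (hω₁ : 0 < M.ω₁) (hω₂ : 0 < M.ω₂) :
    M.D (M.D M.B₁x) = M.J₁₃ • (-M.ω₁ ^ 2 • M.normalCoord (.inr 0))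
      + M.J₁₄ • (M.ω₂ ^ 2 • -M.normalCoord (.inr 1)) := by
  rw [D_B₁x hω₁ hω₂]
  exact ((((hasD_normalCoord_inl_zero hω₁).const_smul _).const_smul _).add
    (((hasD_normalCoord_inl_one hω₂).const_smul _).const_smul _)).D_eq

theorem D_D_B₁y (hω₁ : 0 < M.ω₁) (hω₂ : 0 < M.ω₂) :
    M.D (M.D M.B₁y) = M.J₂₁ • (-M.ω₁ ^ 2 • M.normalCoord (.inl 0))
      + M.J₂₂ • -(M.ω₂ ^ 2 • M.normalCoord (.inl 1))
      + (M.J₂₃ • (-M.ω₁ ^ 2 • M.normalCoord (.inr 0))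
        + M.J₂₄ • (M.ω₂ ^ 2 • -M.normalCoord (.inr 1))) := by
  rw [D_B₁y hω₁ hω₂]
  exact ((((hasD_normalCoord_inr_zero hω₁).const_smul _).add
    ((hasD_normalCoord_inr_one hω₂).neg.const_smul _)).add
    ((((hasD_normalCoord_inl_zero hω₁).const_smul _).const_smul _).add
    (((hasD_normalCoord_inl_one hω₂).const_smul _).const_smul _))).D_eq

theorem firstOrder_x (hfreq : M.HasFrequencies) (hF : 2 * M.F < M.n ^ 2) (I₁ I₂ φ₁ φ₂ : ℝ) :
    M.D (M.D M.B₁x) I₁ I₂ φ₁ φ₂ + (2 * M.E - M.n ^ 2) * M.B₁x I₁ I₂ φ₁ φ₂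
      - (2 * M.n * M.D M.B₁y I₁ I₂ φ₁ φ₂ - M.G * M.B₁y I₁ I₂ φ₁ φ₂) = 0 := by
  have hω₁ := ω₁_pos hfreq
  have hG := G_sq_eq hfreq
  have hE : M.E = (M.ω₁ ^ 2 + M.ω₂ ^ 2) / 2 - M.F - M.n ^ 2 := by
    linear_combination -(sq_add_sq_frequencies hfreq) / 2
  rw [D_D_B₁x hω₁ hfreq.1, D_B₁y hω₁ hfreq.1, B₁x_eq, B₁y_eq, J₁₃_eq hF, J₁₄_eq hF,
    J₂₁_eq hω₁.ne', J₂₂_eq hfreq.1.ne', J₂₃_eq, J₂₄_eq, hE]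
  simp only [Pi.add_apply, Pi.smul_apply, Pi.neg_apply, smul_eq_mul]
  linear_combination (M.amplitude M.ω₁ * M.normalCoord (.inr 0) I₁ I₂ φ₁ φ₂
    + M.amplitude M.ω₂ * M.normalCoord (.inr 1) I₁ I₂ φ₁ φ₂) * hG

theorem firstOrder_y (hfreq : M.HasFrequencies) (hF : 2 * M.F < M.n ^ 2) (I₁ I₂ φ₁ φ₂ : ℝ) :
    2 * M.n * M.D M.B₁x I₁ I₂ φ₁ φ₂ + M.G * M.B₁x I₁ I₂ φ₁ φ₂
      + (M.D (M.D M.B₁y) I₁ I₂ φ₁ φ₂ + (2 * M.F - M.n ^ 2) * M.B₁y I₁ I₂ φ₁ φ₂) = 0 := by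
  have hω₁ := ω₁_pos hfreq
  rw [D_D_B₁y hω₁ hfreq.1, D_B₁x hω₁ hfreq.1, B₁x_eq, B₁y_eq, J₁₃_eq hF, J₁₄_eq hF,
    J₂₁_eq hω₁.ne', J₂₂_eq hfreq.1.ne', J₂₃_eq, J₂₄_eq]
  simp only [Pi.add_apply, Pi.smul_apply, Pi.neg_apply, smul_eq_mul]
  ring

end FirstOrder

section SecondOrder

open scoped ContDiff

theorem X₂_eq (hz : M.zs + M.μ ≠ 0) (hV : ContDiffAt ℝ ω M.V M.zs) (hω₁ : 0 < M.ω₁)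
    (hω₂ : 0 < M.ω₂) :
    M.X₂ = fun I₁ I₂ φ₁ φ₂ => binaryCubicX (cubicTaylorCoeff M.V M.zs)
      (M.B₁x I₁ I₂ φ₁ φ₂) (M.B₁y I₁ I₂ φ₁ φ₂) := by
  set c := cubicTaylorCoeff M.S M.zs with hc
  have hderiv_x (x y u v : ℝ) : deriv (fun t => M.Lpart 3 t y u v) x
      = binaryCubicX (cubicTaylorCoeff M.V M.zs) x y
        + 6 * ((c 0 * x + c 1 * y) * u + (c 1 * x + c 2 * y) * v) := by
    simp only [Lpart_three hz hV]
    refine ((((hasDerivAt_binaryCubic _ (hasDerivAt_id' x) (hasDerivAt_const x y)).fun_add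
      ((hasDerivAt_binaryCubicX _ (hasDerivAt_id' x) (hasDerivAt_const x y)).mul_const u)).fun_add
      ((hasDerivAt_binaryCubicY _ (hasDerivAt_id' x)
        (hasDerivAt_const x y)).mul_const v)).deriv).trans ?_
    ring
  have hderiv_u (x y u v : ℝ) :
      deriv (fun t => M.Lpart 3 x y t v) u = binaryCubicX c x y := by
    simp only [Lpart_three hz hV]
    simp [hc]
  have hD : M.D (M.alongFirstOrder fun x y _ _ => binaryCubicX c x y) = _ :=
    ((M.hasD_D_of_mem (B₁x_mem_dAlembertSpace hω₁ hω₂)).binaryCubicX c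
      (M.hasD_D_of_mem (B₁y_mem_dAlembertSpace hω₁ hω₂))).D_eq
  funext I₁ I₂ φ₁ φ₂
  simp only [X₂, hderiv_x, hderiv_u, hD, alongFirstOrder, add_sub_cancel_right]

theorem Y₂_eq (hz : M.zs + M.μ ≠ 0) (hV : ContDiffAt ℝ ω M.V M.zs) (hω₁ : 0 < M.ω₁)
    (hω₂ : 0 < M.ω₂) :
    M.Y₂ = fun I₁ I₂ φ₁ φ₂ => binaryCubicY (cubicTaylorCoeff M.V M.zs)
      (M.B₁x I₁ I₂ φ₁ φ₂) (M.B₁y I₁ I₂ φ₁ φ₂) := by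
  set c := cubicTaylorCoeff M.S M.zs with hc
  have hderiv_y (x y u v : ℝ) : deriv (fun t => M.Lpart 3 x t u v) y
      = binaryCubicY (cubicTaylorCoeff M.V M.zs) x y
        + 6 * ((c 1 * x + c 2 * y) * u + (c 2 * x + c 3 * y) * v) := by
    simp only [Lpart_three hz hV]
    refine ((((hasDerivAt_binaryCubic _ (hasDerivAt_const y x) (hasDerivAt_id' y)).fun_add
      ((hasDerivAt_binaryCubicX _ (hasDerivAt_const y x) (hasDerivAt_id' y)).mul_const u)).fun_add
      ((hasDerivAt_binaryCubicY _ (hasDerivAt_const y x)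
        (hasDerivAt_id' y)).mul_const v)).deriv).trans ?_
    ring
  have hderiv_v (x y u v : ℝ) :
      deriv (fun t => M.Lpart 3 x y u t) v = binaryCubicY c x y := by
    simp only [Lpart_three hz hV]
    simp [hc]
  have hD : M.D (M.alongFirstOrder fun x y _ _ => binaryCubicY c x y) = _ :=
    ((M.hasD_D_of_mem (B₁x_mem_dAlembertSpace hω₁ hω₂)).binaryCubicY c
      (M.hasD_D_of_mem (B₁y_mem_dAlembertSpace hω₁ hω₂))).D_eq
  funext I₁ I₂ φ₁ φ₂
  simp only [Y₂, hderiv_y, hderiv_v, hD, alongFirstOrder, add_sub_cancel_right]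

theorem X₂_mem_dAlembertSpace (hz : M.zs + M.μ ≠ 0) (hV : ContDiffAt ℝ ω M.V M.zs)
    (hω₁ : 0 < M.ω₁) (hω₂ : 0 < M.ω₂) : M.X₂ ∈ dAlembertSpace 2 := by
  rw [X₂_eq hz hV hω₁ hω₂]
  exact binaryCubicX_comp_mem_dAlembertSpace (k := 1) _
    (B₁x_mem_dAlembertSpace hω₁ hω₂) (B₁y_mem_dAlembertSpace hω₁ hω₂)

theorem Y₂_mem_dAlembertSpace (hz : M.zs + M.μ ≠ 0) (hV : ContDiffAt ℝ ω M.V M.zs)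
    (hω₁ : 0 < M.ω₁) (hω₂ : 0 < M.ω₂) : M.Y₂ ∈ dAlembertSpace 2 := by
  rw [Y₂_eq hz hV hω₁ hω₂]
  exact binaryCubicY_comp_mem_dAlembertSpace (k := 1) _
    (B₁x_mem_dAlembertSpace hω₁ hω₂) (B₁y_mem_dAlembertSpace hω₁ hω₂)

end SecondOrder

section LinearSystem

/-- The symbol of the operator `D² + a`. -/
noncomputable def symbolQuadratic (M : PRModel) (a : ℝ) : FourierCoeff :=
  M.symbolD ^ 2 + fun _ _ _ => (a : ℂ)

/-- The symbol of the operator `2nD + b`. -/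
noncomputable def symbolLinear (M : PRModel) (b : ℝ) : FourierCoeff :=
  fun m p q => 2 * M.n * M.symbolD m p q + b

/-- The left-hand sides of the equations of second order, acting on the Fourier coefficients of
the two unknown components. -/
noncomputable def secondOrderSymbol (M : PRModel) :
    FourierCoeff × FourierCoeff →ₗ[ℝ] FourierCoeff × FourierCoeff where
  toFun b := (M.symbolQuadratic (2 * M.E - M.n ^ 2) * b.1 - M.symbolLinear (-M.G) * b.2,
    M.symbolLinear M.G * b.1 + M.symbolQuadratic (2 * M.F - M.n ^ 2) * b.2)
  map_add' b c := by
    simp only [Prod.fst_add, Prod.snd_add, Prod.mk_add_mk]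
    congr 1 <;> ring
  map_smul' r b := by
    simp only [Prod.smul_fst, Prod.smul_snd, mul_smul_comm, smul_sub, smul_add, RingHom.id_apply,
      Prod.smul_mk]

/-- The coefficients of `Φ₂` and `Ψ₂` in terms of those of `X₂` and `Y₂`: up to the sign of the
second component, the adjugate of `secondOrderSymbol`. -/
noncomputable def cramerSymbol (M : PRModel) (c : FourierCoeff × FourierCoeff) :
    FourierCoeff × FourierCoeff :=
  (M.symbolQuadratic (2 * M.F - M.n ^ 2) * c.1 + M.symbolLinear (-M.G) * c.2,
    M.symbolLinear M.G * c.1 - M.symbolQuadratic (2 * M.E - M.n ^ 2) * c.2)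

theorem symbol_det (hfreq : M.HasFrequencies) (m p : ℕ) (q : ℤ) :
    M.symbolQuadratic (2 * M.E - M.n ^ 2) m p q * M.symbolQuadratic (2 * M.F - M.n ^ 2) m p q
      + M.symbolLinear (-M.G) m p q * M.symbolLinear M.G m p q = M.Δ p q := by
  have hsum : (M.ω₁ ^ 2 + M.ω₂ ^ 2 : ℂ) = 2 * (M.E + M.F + M.n ^ 2) := by
    exact_mod_cast sq_add_sq_frequencies hfreq
  have hprod : (M.ω₁ ^ 2 * M.ω₂ ^ 2 : ℂ)
      = (2 * M.E - M.n ^ 2) * (2 * M.F - M.n ^ 2) - M.G ^ 2 := by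
    exact_mod_cast sq_mul_sq_frequencies hfreq
  simp only [symbolQuadratic, symbolLinear, symbolD, Pi.add_apply, Pi.pow_apply, Δ, freq,
    Int.cast_natCast]
  push_cast
  generalize (M.ω₁ * p - M.ω₂ * q : ℂ) = ν
  linear_combination ν ^ 2 * hsum - hprod + 4 * M.n ^ 2 * ν ^ 2 * Complex.I_sq
    + ν ^ 2 * (2 * M.E - M.n ^ 2 + (2 * M.F - M.n ^ 2) + (Complex.I ^ 2 - 1) * ν ^ 2)
      * Complex.I_sq

theorem D_D_add_mul_fourierComp (k : ℕ) (c : FourierCoeff) (a I₁ I₂ φ₁ φ₂ : ℝ) :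
    M.D (M.D (fourierComp k c)) I₁ I₂ φ₁ φ₂ + a * fourierComp k c I₁ I₂ φ₁ φ₂
      = fourierComp k (M.symbolQuadratic a * c) I₁ I₂ φ₁ φ₂ := by
  have hc : M.symbolQuadratic a * c = M.symbolD * (M.symbolD * c) + a • c := by
    funext m p q
    simp only [symbolQuadratic, Pi.add_apply, Pi.mul_apply, Pi.pow_apply, Pi.smul_apply,
      Complex.real_smul]
    ring
  rw [hc, map_add, map_smul, D_fourierComp, D_fourierComp]
  rfl

theorem two_n_mul_D_add_mul_fourierComp (k : ℕ) (c : FourierCoeff) (b I₁ I₂ φ₁ φ₂ : ℝ) :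
    2 * M.n * M.D (fourierComp k c) I₁ I₂ φ₁ φ₂ + b * fourierComp k c I₁ I₂ φ₁ φ₂
      = fourierComp k (M.symbolLinear b * c) I₁ I₂ φ₁ φ₂ := by
  have hc : M.symbolLinear b * c = (2 * M.n) • (M.symbolD * c) + b • c := by
    funext m p q
    simp only [symbolLinear, Pi.add_apply, Pi.mul_apply, Pi.smul_apply, Complex.real_smul]
    push_cast
    ring
  rw [hc, map_add, map_smul, map_smul, D_fourierComp]
  rfl

theorem two_n_mul_D_sub_mul_fourierComp (k : ℕ) (c : FourierCoeff) (b I₁ I₂ φ₁ φ₂ : ℝ) :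
    2 * M.n * M.D (fourierComp k c) I₁ I₂ φ₁ φ₂ - b * fourierComp k c I₁ I₂ φ₁ φ₂
      = fourierComp k (M.symbolLinear (-b) * c) I₁ I₂ φ₁ φ₂ := by
  rw [← two_n_mul_D_add_mul_fourierComp, neg_mul, sub_eq_add_neg]

theorem fourierComp_secondOrderSymbol_fst (k : ℕ) (b : FourierCoeff × FourierCoeff)
    (I₁ I₂ φ₁ φ₂ : ℝ) :
    fourierComp k (M.secondOrderSymbol b).1 I₁ I₂ φ₁ φ₂
      = (M.D (M.D (fourierComp k b.1)) I₁ I₂ φ₁ φ₂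
          + (2 * M.E - M.n ^ 2) * fourierComp k b.1 I₁ I₂ φ₁ φ₂)
        - (2 * M.n * M.D (fourierComp k b.2) I₁ I₂ φ₁ φ₂
          - M.G * fourierComp k b.2 I₁ I₂ φ₁ φ₂) := by
  rw [D_D_add_mul_fourierComp, two_n_mul_D_sub_mul_fourierComp]
  change fourierComp k (_ - _) I₁ I₂ φ₁ φ₂ = _
  rw [map_sub]
  rfl

theorem fourierComp_secondOrderSymbol_snd (k : ℕ) (b : FourierCoeff × FourierCoeff)
    (I₁ I₂ φ₁ φ₂ : ℝ) :
    fourierComp k (M.secondOrderSymbol b).2 I₁ I₂ φ₁ φ₂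
      = (2 * M.n * M.D (fourierComp k b.1) I₁ I₂ φ₁ φ₂
          + M.G * fourierComp k b.1 I₁ I₂ φ₁ φ₂)
        + (M.D (M.D (fourierComp k b.2)) I₁ I₂ φ₁ φ₂
          + (2 * M.F - M.n ^ 2) * fourierComp k b.2 I₁ I₂ φ₁ φ₂) := by
  rw [D_D_add_mul_fourierComp, two_n_mul_D_add_mul_fourierComp]
  change fourierComp k (_ + _) I₁ I₂ φ₁ φ₂ = _
  rw [map_add]
  rfl

theorem Φ₂_eq_fourierComp {k : ℕ} {c : FourierCoeff × FourierCoeff}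
    (hX : M.X₂ = fourierComp k c.1) (hY : M.Y₂ = fourierComp k c.2) :
    M.Φ₂ = fourierComp k (M.cramerSymbol c).1 := by
  funext I₁ I₂ φ₁ φ₂
  rw [Φ₂, hX, hY, D_D_add_mul_fourierComp, two_n_mul_D_sub_mul_fourierComp, cramerSymbol, map_add]
  rfl

theorem Ψ₂_eq_fourierComp {k : ℕ} {c : FourierCoeff × FourierCoeff}
    (hX : M.X₂ = fourierComp k c.1) (hY : M.Y₂ = fourierComp k c.2) :
    M.Ψ₂ = fourierComp k (M.cramerSymbol c).2 := by
  funext I₁ I₂ φ₁ φ₂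
  rw [Ψ₂, hX, hY, D_D_add_mul_fourierComp, two_n_mul_D_add_mul_fourierComp, cramerSymbol, map_sub]
  rfl

/-- Cramer's solution of the equations of second order with right-hand sides `c`. -/
noncomputable def secondOrderSolution (M : PRModel) (c : FourierCoeff × FourierCoeff) :
    FourierCoeff × FourierCoeff :=
  (fun m p q => (M.cramerSymbol c).1 m p q / M.Δ p q,
    fun m p q => -(M.cramerSymbol c).2 m p q / M.Δ p q)

section Solution

variable {k : ℕ} (hfreq : M.HasFrequencies)
  (hΔ : ∀ m ∈ Finset.range (k + 1), ∀ p ∈ dAlembertP (k - m), ∀ q ∈ dAlembertQ m, M.Δ p q ≠ 0)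

include hfreq hΔ

theorem prodMap_fourierComp_secondOrderSolution (c : FourierCoeff × FourierCoeff) :
    (fourierComp k).prodMap (fourierComp k) (M.secondOrderSymbol (M.secondOrderSolution c))
      = (fourierComp k).prodMap (fourierComp k) c := by
  refine Prod.ext (fourierComp_congr fun m hm p hp q hq => ?_)
    (fourierComp_congr fun m hm p hp q hq => ?_)
  all_goals
    have hne : (M.Δ p q : ℂ) ≠ 0 := Complex.ofReal_ne_zero.mpr (hΔ m hm p hp q hq)
    have hdet := symbol_det hfreq m p q
    simp only [LinearMap.fst_apply, LinearMap.snd_apply, secondOrderSymbol, secondOrderSolution,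
      cramerSymbol, LinearMap.coe_mk, AddHom.coe_mk, Pi.add_apply, Pi.sub_apply, Pi.mul_apply]
    field_simp
  · linear_combination c.1 m p q * hdet
  · linear_combination c.2 m p q * hdet

theorem prodMap_fourierComp_eq_of_secondOrderSymbol_eq {b c : FourierCoeff × FourierCoeff}
    (h : (fourierComp k).prodMap (fourierComp k) (M.secondOrderSymbol b)
      = (fourierComp k).prodMap (fourierComp k) (M.secondOrderSymbol c)) :
    (fourierComp k).prodMap (fourierComp k) b = (fourierComp k).prodMap (fourierComp k) c := by
  have : FiniteDimensional ℝ (LinearMap.range ((fourierComp k).prodMap (fourierComp k))) := by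
    rw [LinearMap.range_prodMap]
    exact Module.Finite.iff_fg.mpr
      ((Module.Finite.iff_fg.mp inferInstance).prod (Module.Finite.iff_fg.mp inferInstance))
  rw [← sub_eq_zero, ← map_sub] at h ⊢
  rw [← map_sub] at h
  refine map_eq_zero_of_map_apply_eq_zero (A := M.secondOrderSymbol) (fun d hd => ?_)
    (fun d => ⟨_, prodMap_fourierComp_secondOrderSolution hfreq hΔ d⟩) h
  obtain ⟨hd₁, hd₂⟩ := Prod.ext_iff.mp hd
  simp only [LinearMap.prodMap_apply, Prod.fst_zero, Prod.snd_zero] at hd₁ hd₂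
  ext I₁ I₂ φ₁ φ₂
  · refine (fourierComp_secondOrderSymbol_fst k d I₁ I₂ φ₁ φ₂).trans ?_
    simp [hd₁, hd₂, D]
  · refine (fourierComp_secondOrderSymbol_snd k d I₁ I₂ φ₁ φ₂).trans ?_
    simp [hd₁, hd₂, D]

end Solution

theorem solvesSecondOrder_fourierComp_iff {k : ℕ} {b c : FourierCoeff × FourierCoeff}
    (hX : M.X₂ = fourierComp k c.1) (hY : M.Y₂ = fourierComp k c.2) :
    M.SolvesSecondOrder (fourierComp k b.1) (fourierComp k b.2)
      ↔ (fourierComp k).prodMap (fourierComp k) (M.secondOrderSymbol b)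
        = (fourierComp k).prodMap (fourierComp k) c := by
  simp only [SolvesSecondOrder, ← fourierComp_secondOrderSymbol_fst,
    ← fourierComp_secondOrderSymbol_snd, hX, hY, LinearMap.prodMap_apply, Prod.mk.injEq]
  exact and_congr ⟨eq_of_agree ⟨_, rfl⟩ ⟨_, rfl⟩, fun h _ _ _ _ _ _ => by rw [h]⟩
    ⟨eq_of_agree ⟨_, rfl⟩ ⟨_, rfl⟩, fun h _ _ _ _ _ _ => by rw [h]⟩

theorem D_agree {f g : ActionAngleFun} (h : f.Agree g) : (M.D f).Agree (M.D g) := by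
  intro I₁ I₂ φ₁ φ₂ hI₁ hI₂
  simp only [D, h I₁ I₂ _ _ hI₁ hI₂]

theorem SolvesSecondOrder.congr {f g f' g' : ActionAngleFun} (h : M.SolvesSecondOrder f g)
    (hf : f'.Agree f) (hg : g'.Agree g) : M.SolvesSecondOrder f' g' := by
  have hDf := D_agree (M := M) hf
  have hDg := D_agree (M := M) hg
  constructor <;> intro I₁ I₂ φ₁ φ₂ hI₁ hI₂ <;> beta_reduce
  · rw [← h.1 I₁ I₂ φ₁ φ₂ hI₁ hI₂, hf I₁ I₂ φ₁ φ₂ hI₁ hI₂, hg I₁ I₂ φ₁ φ₂ hI₁ hI₂,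
      D_agree hDf I₁ I₂ φ₁ φ₂ hI₁ hI₂, hDg I₁ I₂ φ₁ φ₂ hI₁ hI₂]
  · rw [← h.2 I₁ I₂ φ₁ φ₂ hI₁ hI₂, hf I₁ I₂ φ₁ φ₂ hI₁ hI₂, hg I₁ I₂ φ₁ φ₂ hI₁ hI₂,
      hDf I₁ I₂ φ₁ φ₂ hI₁ hI₂, D_agree hDg I₁ I₂ φ₁ φ₂ hI₁ hI₂]

theorem fourierComp_div_ofReal (k : ℕ) (c : FourierCoeff) (d : ℕ → ℤ → ℝ) :
    fourierComp k (fun m p q => c m p q / d p q)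
      = dAlembertComp k (fun m p q => (c m p q).re / d p q)
        (fun m p q => -(c m p q).im / d p q) := by
  simp only [fourierComp_eq_dAlembertComp, Complex.div_ofReal_re, Complex.div_ofReal_im, neg_div]

end LinearSystem

section SecondOrderSolution

variable {k : ℕ} {c : FourierCoeff × FourierCoeff}

theorem solvesSecondOrder_secondOrderSolution (hfreq : M.HasFrequencies)
    (hΔ : ∀ m ∈ Finset.range (k + 1), ∀ p ∈ dAlembertP (k - m), ∀ q ∈ dAlembertQ m, M.Δ p q ≠ 0)
    (hX : M.X₂ = fourierComp k c.1) (hY : M.Y₂ = fourierComp k c.2) :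
    M.SolvesSecondOrder (fourierComp k (M.secondOrderSolution c).1)
      (fourierComp k (M.secondOrderSolution c).2) :=
  (solvesSecondOrder_fourierComp_iff hX hY).mpr
    (prodMap_fourierComp_secondOrderSolution hfreq hΔ c)

theorem SolvesSecondOrder.agree_secondOrderSolution {Bx By : ActionAngleFun}
    (hsol : M.SolvesSecondOrder Bx By) (hfreq : M.HasFrequencies)
    (hΔ : ∀ m ∈ Finset.range (k + 1), ∀ p ∈ dAlembertP (k - m), ∀ q ∈ dAlembertQ m, M.Δ p q ≠ 0)
    (hX : M.X₂ = fourierComp k c.1) (hY : M.Y₂ = fourierComp k c.2)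
    (hBx : IsDAlembertComp k Bx) (hBy : IsDAlembertComp k By) :
    Bx.Agree (fourierComp k (M.secondOrderSolution c).1) ∧
      By.Agree (fourierComp k (M.secondOrderSolution c).2) := by
  obtain ⟨_, ⟨b₁, rfl⟩, hb₁⟩ := isDAlembertComp_iff.mp hBx
  obtain ⟨_, ⟨b₂, rfl⟩, hb₂⟩ := isDAlembertComp_iff.mp hBy
  have hb := (solvesSecondOrder_fourierComp_iff (b := (b₁, b₂)) hX hY).mp
    (hsol.congr hb₁.symm hb₂.symm)
  have heq := prodMap_fourierComp_eq_of_secondOrderSymbol_eq hfreq hΔ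
    (hb.trans (prodMap_fourierComp_secondOrderSolution hfreq hΔ c).symm)
  simp only [LinearMap.prodMap_apply, Prod.mk.injEq] at heq
  exact ⟨heq.1 ▸ hb₁, heq.2 ▸ hb₂⟩

theorem secondOrderSolution_coefficients (hX : M.X₂ = fourierComp k c.1)
    (hY : M.Y₂ = fourierComp k c.2) :
    ∃ CΦ SΦ CΨ SΨ : ℕ → ℕ → ℤ → ℝ,
      M.Φ₂.Agree (dAlembertComp k CΦ SΦ) ∧ M.Ψ₂.Agree (dAlembertComp k CΨ SΨ) ∧
      (fourierComp k (M.secondOrderSolution c).1).Agree (dAlembertComp k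
        (fun m p q => CΦ m p q / M.Δ p q) (fun m p q => SΦ m p q / M.Δ p q)) ∧
      (fourierComp k (M.secondOrderSolution c).2).Agree (dAlembertComp k
        (fun m p q => -CΨ m p q / M.Δ p q) (fun m p q => -SΨ m p q / M.Δ p q)) :=
  ⟨_, _, _, _,
    .of_eq ((Φ₂_eq_fourierComp hX hY).trans (fourierComp_eq_dAlembertComp _ _)),
    .of_eq ((Ψ₂_eq_fourierComp hX hY).trans (fourierComp_eq_dAlembertComp _ _)),
    .of_eq (fourierComp_div_ofReal k (M.cramerSymbol c).1 M.Δ),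
    .of_eq (fourierComp_div_ofReal k (-(M.cramerSymbol c).2) M.Δ)⟩

end SecondOrderSolution

section NonResonance

theorem freq_ne_zero_of_degree_three (hres : M.NonResonant) :
    ∀ m ∈ Finset.range 4, ∀ p ∈ dAlembertP (3 - m), ∀ q ∈ dAlembertQ m, M.freq p q ≠ 0 := by
  intro m hm p hp q hq hzero
  simp only [Finset.mem_range, dAlembertP, dAlembertQ, Finset.mem_filter, Finset.mem_Icc]
    at hm hp hq
  refine hres p (-q) (by rw [Ne, Prod.mk.injEq]; omega) (by simp only [abs_eq_max_neg]; omega) ?_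
  rw [freq] at hzero
  push_cast at hzero ⊢
  linear_combination hzero

theorem Δ_ne_zero_of_degree_two (hres : M.NonResonant) :
    ∀ m ∈ Finset.range 3, ∀ p ∈ dAlembertP (2 - m), ∀ q ∈ dAlembertQ m, M.Δ p q ≠ 0 := by
  intro m hm p hp q hq
  simp only [Finset.mem_range, dAlembertP, dAlembertQ, Finset.mem_filter, Finset.mem_Icc]
    at hm hp hq
  have hfactor {k₁ k₂ : ℤ} (hk : (k₁ ≠ 0 ∨ k₂ ≠ 0) ∧ max k₁ (-k₁) + max k₂ (-k₂) ≤ 4) :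
      (k₁ : ℝ) * M.ω₁ + k₂ * M.ω₂ ≠ 0 :=
    hres k₁ k₂ (by rw [Ne, Prod.mk.injEq]; omega) hk.2
  have hΔ : M.Δ p q
      = (((1 - p : ℤ) : ℝ) * M.ω₁ + q * M.ω₂) * (((1 + p : ℤ) : ℝ) * M.ω₁ + (-q : ℤ) * M.ω₂)
        * -((((p : ℤ) : ℝ) * M.ω₁ + (-q - 1 : ℤ) * M.ω₂)
          * (((p : ℤ) : ℝ) * M.ω₁ + (-q + 1 : ℤ) * M.ω₂)) := by
    rw [Δ]
    push_cast
    ring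
  rw [hΔ]
  exact mul_ne_zero (mul_ne_zero (hfactor (by omega)) (hfactor (by omega)))
    (neg_ne_zero.mpr (mul_ne_zero (hfactor (by omega)) (hfactor (by omega))))

end NonResonance

section Energy

open scoped ContDiff

variable {Bx By : ActionAngleFun}

theorem H₃_eq (hV : ContDiffAt ℝ ω M.V M.zs) (Bx By : ActionAngleFun) :
    M.H₃ Bx By = M.D M.B₁x * M.D Bx + M.D M.B₁y * M.D By
      + -(fun I₁ I₂ φ₁ φ₂ => binaryCubic (cubicTaylorCoeff M.V M.zs)
        (M.B₁x I₁ I₂ φ₁ φ₂) (M.B₁y I₁ I₂ φ₁ φ₂))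
      + (2 * M.E - M.n ^ 2) • (M.B₁x * Bx) + M.G • (M.B₁x * By + M.B₁y * Bx)
      + (2 * M.F - M.n ^ 2) • (M.B₁y * By) := by
  funext I₁ I₂ φ₁ φ₂
  rw [H₃, iteratedDeriv_three_H hV]
  simp only [Pi.add_apply, Pi.mul_apply, Pi.neg_apply, Pi.smul_apply, smul_eq_mul]
  ring

theorem H₃_mem_dAlembertSpace (hV : ContDiffAt ℝ ω M.V M.zs) (hω₁ : 0 < M.ω₁) (hω₂ : 0 < M.ω₂)
    (hBx : Bx ∈ dAlembertSpace 2) (hBy : By ∈ dAlembertSpace 2) :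
    M.H₃ Bx By ∈ dAlembertSpace 3 := by
  have hx := B₁x_mem_dAlembertSpace hω₁ hω₂
  have hy := B₁y_mem_dAlembertSpace hω₁ hω₂
  have hDx : M.D M.B₁x ∈ dAlembertSpace 1 := D_mem_dAlembertSpace hx
  have hDy : M.D M.B₁y ∈ dAlembertSpace 1 := D_mem_dAlembertSpace hy
  have hcubic := binaryCubic_comp_mem_dAlembertSpace (cubicTaylorCoeff M.V M.zs) hx hy
  have hmul {f g : ActionAngleFun} (hf : f ∈ dAlembertSpace 1) (hg : g ∈ dAlembertSpace 2) :
      f * g ∈ dAlembertSpace 3 :=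
    mul_mem_dAlembertSpace (k := 1) (l := 2) hf hg
  rw [H₃_eq hV]
  refine add_mem (add_mem (add_mem (add_mem (add_mem ?_ ?_) (neg_mem hcubic)) ?_) ?_) ?_
  · exact hmul hDx (D_mem_dAlembertSpace hBx)
  · exact hmul hDy (D_mem_dAlembertSpace hBy)
  · exact Submodule.smul_mem _ _ (hmul hx hBx)
  · exact Submodule.smul_mem _ _ (add_mem (hmul hx hBy) (hmul hy hBx))
  · exact Submodule.smul_mem _ _ (hmul hy hBy)

theorem D_H₃_eq_zero (hz : M.zs + M.μ ≠ 0) (hV : ContDiffAt ℝ ω M.V M.zs)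
    (hfreq : M.HasFrequencies) (hF : 2 * M.F < M.n ^ 2) (hBx : Bx ∈ dAlembertSpace 2)
    (hBy : By ∈ dAlembertSpace 2) (hsol : M.SolvesSecondOrder Bx By) :
    M.D (M.H₃ Bx By) = 0 := by
  have hω₁ := ω₁_pos hfreq
  have hx := B₁x_mem_dAlembertSpace hω₁ hfreq.1
  have hy := B₁y_mem_dAlembertSpace hω₁ hfreq.1
  have hDx := hasD_D_of_mem (M := M) hx
  have hDy := hasD_D_of_mem (M := M) hy
  have hDBx := hasD_D_of_mem (M := M) hBx
  have hDBy := hasD_D_of_mem (M := M) hBy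
  have hDDx := hasD_D_of_mem (M := M) (D_mem_dAlembertSpace (M := M) hx)
  have hDDy := hasD_D_of_mem (M := M) (D_mem_dAlembertSpace (M := M) hy)
  have hDDBx := hasD_D_of_mem (M := M) (D_mem_dAlembertSpace (M := M) hBx)
  have hDDBy := hasD_D_of_mem (M := M) (D_mem_dAlembertSpace (M := M) hBy)
  have hDH₃ := ((((((hDDx.mul hDDBx).add (hDDy.mul hDDBy)).add
    (hDx.binaryCubic (cubicTaylorCoeff M.V M.zs) hDy).neg).add
    ((hDx.mul hDBx).const_smul (2 * M.E - M.n ^ 2))).add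
    (((hDx.mul hDBy).add (hDy.mul hDBx)).const_smul M.G)).add
    ((hDy.mul hDBy).const_smul (2 * M.F - M.n ^ 2))).D_eq
  refine eq_of_agree (D_mem_dAlembertSpace (H₃_mem_dAlembertSpace hV hω₁ hfreq.1 hBx hBy))
    (zero_mem _) fun I₁ I₂ φ₁ φ₂ hI₁ hI₂ => ?_
  have hX := hsol.1 I₁ I₂ φ₁ φ₂ hI₁ hI₂
  have hY := hsol.2 I₁ I₂ φ₁ φ₂ hI₁ hI₂
  rw [X₂_eq hz hV hω₁ hfreq.1] at hX
  rw [Y₂_eq hz hV hω₁ hfreq.1] at hY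
  rw [H₃_eq hV, hDH₃]
  simp only [Pi.add_apply, Pi.mul_apply, Pi.neg_apply, Pi.smul_apply, Pi.zero_apply, smul_eq_mul]
  linear_combination M.D M.B₁x I₁ I₂ φ₁ φ₂ * hX + M.D M.B₁y I₁ I₂ φ₁ φ₂ * hY
    + M.D Bx I₁ I₂ φ₁ φ₂ * firstOrder_x hfreq hF I₁ I₂ φ₁ φ₂
    + M.D By I₁ I₂ φ₁ φ₂ * firstOrder_y hfreq hF I₁ I₂ φ₁ φ₂

theorem H₃_eq_zero (hz : M.zs + M.μ ≠ 0) (hV : ContDiffAt ℝ ω M.V M.zs)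
    (hfreq : M.HasFrequencies) (hres : M.NonResonant) (hF : 2 * M.F < M.n ^ 2)
    (hBx : Bx ∈ dAlembertSpace 2) (hBy : By ∈ dAlembertSpace 2)
    (hsol : M.SolvesSecondOrder Bx By) : M.H₃ Bx By = 0 :=
  eq_zero_of_D_eq_zero (H₃_mem_dAlembertSpace hV (ω₁_pos hfreq) hfreq.1 hBx hBy)
    (freq_ne_zero_of_degree_three hres) (D_H₃_eq_zero hz hV hfreq hF hBx hBy hsol)

end Energy

end PRModel

open scoped ContDiff in
open PRModel in
theorem mainTheorem2_general (M : PRModel) (hμ₀ : 0 ≤ M.μ) (hμ₁ : M.μ ≤ 1) (hq₀ : 0 ≤ M.q₁)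
    (hA : 0 ≤ M.A₂) (_hcd : M.cd ≠ 0) (ha : M.xs + M.μ ≠ 0) (hr₂ : M.r₂ M.xs M.ys ≠ 0)
    (hfreq : M.HasFrequencies) (hres : M.NonResonant) :
    (M.J ∈ Matrix.symplecticGroup (Fin 2) ℝ ∧
      ∀ I₁ I₂ φ₁ φ₂ : ℝ, 0 ≤ I₁ → 0 ≤ I₂ →
        M.H₂ (Matrix.mulVec M.J (M.T I₁ I₂ φ₁ φ₂)) = M.ω₁ * I₁ - M.ω₂ * I₂) ∧
    IsDAlembertComp 1 M.B₁x ∧ IsDAlembertComp 1 M.B₁y ∧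
    (∀ m ∈ Finset.range 3, ∀ p ∈ dAlembertP (2 - m), ∀ q ∈ dAlembertQ m, M.Δ p q ≠ 0) ∧
    ∃ B₂x B₂y : ActionAngleFun,
      (IsDAlembertComp 2 B₂x ∧ IsDAlembertComp 2 B₂y ∧ M.SolvesSecondOrder B₂x B₂y) ∧
      (∀ Bx By : ActionAngleFun, IsDAlembertComp 2 Bx → IsDAlembertComp 2 By →
        M.SolvesSecondOrder Bx By →
          ActionAngleFun.Agree Bx B₂x ∧ ActionAngleFun.Agree By B₂y) ∧
      (∃ CΦ SΦ CΨ SΨ : ℕ → ℕ → ℤ → ℝ,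
        ActionAngleFun.Agree M.Φ₂ (dAlembertComp 2 CΦ SΦ) ∧
        ActionAngleFun.Agree M.Ψ₂ (dAlembertComp 2 CΨ SΨ) ∧
        ActionAngleFun.Agree B₂x (dAlembertComp 2
          (fun m p q => CΦ m p q / M.Δ p q) (fun m p q => SΦ m p q / M.Δ p q)) ∧
        ActionAngleFun.Agree B₂y (dAlembertComp 2
          (fun m p q => -CΨ m p q / M.Δ p q) (fun m p q => -SΨ m p q / M.Δ p q))) ∧
      (∀ A₃₀ A₂₁ A₁₂ A₀₃ : ℝ → ℝ → ℝ,
        ActionAngleFun.Agree (M.H₃ B₂x B₂y)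
          (fun I₁ I₂ φ₁ φ₂ => A₃₀ φ₁ φ₂ * √I₁ ^ 3 + A₂₁ φ₁ φ₂ * (I₁ * √I₂)
            + A₁₂ φ₁ φ₂ * (√I₁ * I₂) + A₀₃ φ₁ φ₂ * √I₂ ^ 3) ↔
        (A₃₀ = 0 ∧ A₂₁ = 0 ∧ A₁₂ = 0 ∧ A₀₃ = 0)) := by
  have hz : M.zs + M.μ ≠ 0 := add_μ_ne_zero ha
  have hV : ContDiffAt ℝ ω M.V M.zs :=
    contDiffAt_V ha (by rwa [← norm_ne_zero_iff, norm_add_μ_sub_one])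
  have hF : 2 * M.F < M.n ^ 2 := two_F_lt hfreq (E_add_F_lt hμ₀ hμ₁ hq₀ hA ha hr₂)
  have hω₁ := ω₁_pos hfreq
  have hΔ := Δ_ne_zero_of_degree_two hres
  obtain ⟨cX, hX⟩ := X₂_mem_dAlembertSpace hz hV hω₁ hfreq.1
  obtain ⟨cY, hY⟩ := Y₂_mem_dAlembertSpace hz hV hω₁ hfreq.1
  have hsol := solvesSecondOrder_secondOrderSolution (c := (cX, cY)) hfreq hΔ hX.symm hY.symm
  exact ⟨⟨J_mem_symplecticGroup hfreq hF, fun _ _ φ₁ φ₂ hI₁ hI₂ =>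
      H₂_J_mulVec_T hfreq hF hI₁ hI₂ φ₁ φ₂⟩,
    isDAlembertComp_of_mem (B₁x_mem_dAlembertSpace hω₁ hfreq.1),
    isDAlembertComp_of_mem (B₁y_mem_dAlembertSpace hω₁ hfreq.1), hΔ, _, _,
    ⟨isDAlembertComp_of_mem ⟨_, rfl⟩, isDAlembertComp_of_mem ⟨_, rfl⟩, hsol⟩,
    fun _ _ hBx hBy h => h.agree_secondOrderSolution hfreq hΔ hX.symm hY.symm hBx hBy,
    secondOrderSolution_coefficients hX.symm hY.symm,
    agree_cubic_iff (H₃_eq_zero hz hV hfreq hres hF ⟨_, rfl⟩ ⟨_, rfl⟩ hsol)⟩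

theorem mainTheorem2 (M : PRModel)
    (hμ₀ : 0 < M.μ) (hμ : M.μ ≤ 1 / 2) (hq₀ : 0 < M.q₁) (hq : M.q₁ ≤ 1)
    (hA : 0 ≤ M.A₂) (hcd : 0 < M.cd)
    (heq : M.IsTriangularEquilibrium) (ha : M.xs + M.μ ≠ 0)
    (hfreq : M.HasFrequencies) (hres : M.NonResonant) :
    -- the linear normal form and the first order components
    (M.J ∈ Matrix.symplecticGroup (Fin 2) ℝ ∧
      ∀ I₁ I₂ φ₁ φ₂ : ℝ, 0 ≤ I₁ → 0 ≤ I₂ →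
        M.H₂ (Matrix.mulVec M.J (M.T I₁ I₂ φ₁ φ₂)) = M.ω₁ * I₁ - M.ω₂ * I₂) ∧
    IsDAlembertComp 1 M.B₁x ∧ IsDAlembertComp 1 M.B₁y ∧
    -- none of the divisors of the second order vanishes
    (∀ m ∈ Finset.range 3, ∀ p ∈ dAlembertP (2 - m), ∀ q ∈ dAlembertQ m, M.Δ p q ≠ 0) ∧
    ∃ B₂x B₂y : ActionAngleFun,
      -- the second order components solve the two partial differential equations, uniquely
      (IsDAlembertComp 2 B₂x ∧ IsDAlembertComp 2 B₂y ∧ M.SolvesSecondOrder B₂x B₂y) ∧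
      (∀ Bx By : ActionAngleFun, IsDAlembertComp 2 Bx → IsDAlembertComp 2 By →
        M.SolvesSecondOrder Bx By →
          ActionAngleFun.Agree Bx B₂x ∧ ActionAngleFun.Agree By B₂y) ∧
      -- and they are given by dividing the coefficients of `Φ₂` and `-Ψ₂` by the divisors
      (∃ CΦ SΦ CΨ SΨ : ℕ → ℕ → ℤ → ℝ,
        ActionAngleFun.Agree M.Φ₂ (dAlembertComp 2 CΦ SΦ) ∧
        ActionAngleFun.Agree M.Ψ₂ (dAlembertComp 2 CΨ SΨ) ∧
        ActionAngleFun.Agree B₂x (dAlembertComp 2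
          (fun m p q => CΦ m p q / M.Δ p q) (fun m p q => SΦ m p q / M.Δ p q)) ∧
        ActionAngleFun.Agree B₂y (dAlembertComp 2
          (fun m p q => -CΨ m p q / M.Δ p q) (fun m p q => -SΨ m p q / M.Δ p q))) ∧
      -- the third order part of the Hamiltonian has all its coefficients equal to zero
      (∀ A₃₀ A₂₁ A₁₂ A₀₃ : ℝ → ℝ → ℝ,
        ActionAngleFun.Agree (M.H₃ B₂x B₂y)
          (fun I₁ I₂ φ₁ φ₂ => A₃₀ φ₁ φ₂ * √I₁ ^ 3 + A₂₁ φ₁ φ₂ * (I₁ * √I₂)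
            + A₁₂ φ₁ φ₂ * (√I₁ * I₂) + A₀₃ φ₁ φ₂ * √I₂ ^ 3) ↔
        (A₃₀ = 0 ∧ A₂₁ = 0 ∧ A₁₂ = 0 ∧ A₀₃ = 0)) := by
  have hy : 0 < M.ys ^ 2 := sq_pos_of_ne_zero heq.2.2
  have hr₂ : M.r₂ M.xs M.ys ≠ 0 := (Real.sqrt_pos.mpr (by positivity)).ne'
  exact mainTheorem2_general M hμ₀.le (hμ.trans (by norm_num)) hq₀.le hA hcd.ne' ha hr₂ hfreq hres
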